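/- Let $n\ge 2$ be an integer and let $\alpha,\beta,m,M>0$. Put $C_1=(1,0,0)$, $C_2=(-1,0,0)\in\mathbb{R}^3$, and for $q=(q_1,\dots,q_n)\in(\mathbb{R}^3)^n$ put $$V(q)=\sum_{1\le i<j\le n}\frac{m^2}{|q_i-q_j|^{\alpha}}+\sum_{i=1}^n\Big(\frac{mM}{|q_i-C_1|^{\beta}}+\frac{mM}{|q_i-C_2|^{\beta}}\Big).$$ Let $\mathcal H$ be the set of loops $q\in H^1_{2\pi}(\mathbb{R},\mathbb{R}^{3n})$ ($2\pi$-periodic) such that, for all $t$, $q_i(t)\ne q_j(t)$ whenever $i\neq j$, and $q_k(t)\ne C_1,C_2$ for all $k$. For $q\in\mathcal H$ let $$\mathcal A(q)=\int_0^{2\pi}\Big[\frac m2\sum_{i=1}^n|\dot q_i(t)|^2+V(q(t))\Big]dt .$$ Let $\mathcal G=\langle g_1,g_2\rangle$ be a finite group with representations $\rho:\mathcal G\to O(3)$, $\tau:\mathcal G\to O(2)$ (acting on the time circle $\mathbb{R}/2\pi\mathbb{Z}$) and $\sigma:\mathcal G\to\Sigma_n$ such that $$\rho(g_1)=\mathrm{id},\quad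 \sigma(g_1^{-1})i=i-1 \ (\mathrm{mod}\ n),\quad \tau(g_1^{-1})t=t+\tfrac{2\pi}{n};\qquad \rho(g_2)=-\mathrm{id},\quad \sigma(g_2^{-1})i=i,\quad \tau(g_2^{-1})t=t+\pi ,$$ let $\mathcal G$ act on loops by $(g\cdot q)_i(t)=\rho(g)\,q_{\sigma(g^{-1})i}(\tau(g^{-1})t)$, and let $\mathcal H_{\mathcal G}=\{q\in\mathcal H: g\cdot q=q\ \text{for all } g\in\mathcal G\}$. Let $$\Lambda=\Big\{q\in\mathcal H:\ \int_0^{2\pi}q_i(t)\,dt=0,\ q_i(t)=q_1\big(t+(i-1)\tfrac{2\pi}{n}\big)\ \text{for } 1\le i\le n \text{ and all } t\Big\}.$$ Then there is a radius $R>0$ such that $\mathcal A|_{\mathcal H_{\mathcal G}}$ attains its minimum, and its minimizers are exactly the uniform circular motions $$\tilde q_i(t)=R\Big(\cos\big(t+(i-1)\tfrac{2\pi}{n}\big)\,u+\sin\big(t+(i-1)\tfrac{2\pi}{n}\big)\,v\Big),\qquad i=1,\dots,n,$$ with $u,v$ an orthonormal basis of the plane $\{x=0\}$ (the $yoz$-plane);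 thus the minimizer is unique up to phase and sense of rotation, and at every instant the particles are the vertices of a regular $n$-gon centered at the origin. Every such $\tilde q$ also lies in $\Lambda$ and attains the minimum of $\mathcal A$ on $\Lambda$, and it is a collisionless $2\pi$-periodic $C^2$ solution of the equations of motion $$m\ddot q_i(t)=\nabla_{q_i}V(q_1(t),\dots,q_n(t)),\qquad i=1,\dots,n.$$ -/

import Mathlib

open MeasureTheory

noncomputable section

/-- Physical space `ℝ³` with its Euclidean norm. -/
abbrev Space3 : Type := EuclideanSpace ℝ (Fin 3)

/-- The first fixed center `C₁ = (1, 0, 0)`. -/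
def centerOne : Space3 := !₂[1, 0, 0]

/-- The second fixed center `C₂ = (-1, 0, 0)`. -/
def centerTwo : Space3 := !₂[-1, 0, 0]

/-- The potential function `V` of the `n` moving particles. -/
def potential {n : ℕ} (α β m M : ℝ) (q : Fin n → Space3) : ℝ :=
  (∑ i : Fin n, ∑ j ∈ Finset.Ioi i, m ^ 2 / ‖q i - q j‖ ^ α) +
    ∑ i : Fin n, (m * M / ‖q i - centerOne‖ ^ β + m * M / ‖q i - centerTwo‖ ^ β)

/-- `x` belongs to `H¹_{2π}(ℝ, ℝ³)` (continuous representative): it is `2π`-periodic, absolutely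
continuous on a period, and its (almost everywhere defined) derivative is square integrable on
a period. -/
structure IsPeriodicH1 (x : ℝ → Space3) : Prop where
  periodic : Function.Periodic x (2 * Real.pi)
  absolutelyContinuous : AbsolutelyContinuousOnInterval x 0 (2 * Real.pi)
  memLp_deriv : MemLp (deriv x) 2 (volume.restrict (Set.Ioc 0 (2 * Real.pi)))

/-- The set `ℋ` of collisionless `2π`-periodic `H¹` loops of configurations. -/
def loopSpace (n : ℕ) : Set (Fin n → ℝ → Space3) :=
  {q | (∀ i, IsPeriodicH1 (q i)) ∧
    (∀ i j, i ≠ j → ∀ t, q i t ≠ q j t) ∧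
    ∀ k t, q k t ≠ centerOne ∧ q k t ≠ centerTwo}

/-- The Lagrangian action functional `𝒜`. On `loopSpace n` the integrand is integrable, so the
integral is the true (finite) value of the action there. -/
def action {n : ℕ} (α β m M : ℝ) (q : Fin n → ℝ → Space3) : ℝ :=
  ∫ t in (0 : ℝ)..(2 * Real.pi),
    (m / 2 * ∑ i : Fin n, ‖deriv (q i) t‖ ^ 2 + potential α β m M (fun i => q i t))

/-- The set `Λ`: loops in `ℋ` with zero mean which are simple choreographies,
`qᵢ(t) = q₁(t + (i - 1) 2π / n)`; the particles are indexed from `0` here. -/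
def choreographyLoops (n : ℕ) [NeZero n] : Set (Fin n → ℝ → Space3) :=
  {q | q ∈ loopSpace n ∧
    (∀ i, ∫ t in (0 : ℝ)..(2 * Real.pi), q i t = 0) ∧
    ∀ i t, q i t = q 0 (t + (i : ℕ) * (2 * Real.pi / n))}

/-- The action of an element `T` of `O(2)` on times. `O(2)` is the group of linear isometries of
the plane `ℂ`, which acts on the unit circle `≅ ℝ / 2πℤ`; the value is the representative in
`(-π, π]` of the image of the class of `t`. -/
def timeAct (T : ℂ ≃ₗᵢ[ℝ] ℂ) (t : ℝ) : ℝ :=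
  Complex.arg (T (Complex.exp (t * Complex.I)))

/-- The action on `2π`-periodic loops attached to representations `ρ : G → O(3)`,
`τ : G → O(2)`, `σ : G → Σₙ`: `(g · q)ᵢ(t) = ρ(g) q_{σ(g⁻¹) i}(τ(g⁻¹) t)`. -/
def loopAct {n : ℕ} {G : Type*} [Group G] (ρ : G →* (Space3 ≃ₗᵢ[ℝ] Space3))
    (τ : G →* (ℂ ≃ₗᵢ[ℝ] ℂ)) (σ : G →* Equiv.Perm (Fin n)) (g : G)
    (q : Fin n → ℝ → Space3) : Fin n → ℝ → Space3 :=
  fun i t => ρ g (q (σ g⁻¹ i) (timeAct (τ g⁻¹) t))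

/-- The fixed point space `ℋ_G` of the action of `G` on `ℋ`. -/
def fixedLoops {n : ℕ} {G : Type*} [Group G] (ρ : G →* (Space3 ≃ₗᵢ[ℝ] Space3))
    (τ : G →* (ℂ ≃ₗᵢ[ℝ] ℂ)) (σ : G →* Equiv.Perm (Fin n)) :
    Set (Fin n → ℝ → Space3) :=
  {q | q ∈ loopSpace n ∧ ∀ g : G, loopAct ρ τ σ g q = q}

/-- `q` is a uniform circular motion of `n` particles in the `yoz`-plane, with angular speed one:
at every instant the particles are the vertices of a regular `n`-gon centered at the origin, of
circumradius `R`, numbered consecutively. Here `u`, `v` is an orthonormal basis of the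
`yoz`-plane, so that phase and sense of rotation are arbitrary. -/
def IsUniformCircularMotion {n : ℕ} (R : ℝ) (q : Fin n → ℝ → Space3) : Prop :=
  ∃ u v : Space3, u 0 = 0 ∧ v 0 = 0 ∧ ‖u‖ = 1 ∧ ‖v‖ = 1 ∧ inner ℝ u v = 0 ∧
    ∀ (i : Fin n) (t : ℝ),
      q i t = R • (Real.cos (t + (i : ℕ) * (2 * Real.pi / n)) • u +
        Real.sin (t + (i : ℕ) * (2 * Real.pi / n)) • v)

/-- `q` is a classical, collisionless, `2π`-periodic solution of the equations of motion
`m q̈ᵢ = ∇_{qᵢ} V(q₁, …, qₙ)`. -/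
structure IsPeriodicSolution {n : ℕ} (α β m M : ℝ) (q : Fin n → ℝ → Space3) : Prop where
  periodic : ∀ i, Function.Periodic (q i) (2 * Real.pi)
  smooth : ∀ i, ContDiff ℝ 2 (q i)
  noCollision : ∀ i j, i ≠ j → ∀ t, q i t ≠ q j t
  noCenterCollision : ∀ k t, q k t ≠ centerOne ∧ q k t ≠ centerTwo
  equation : ∀ i t,
    HasGradientAt (fun x : Space3 => potential α β m M (Function.update (fun k => q k t) i x))
      (m • deriv (deriv (q i)) t) (q i t)

end

/-! The action is convexified around the circular motion. Written in squared distances, every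
interaction is an integral of `g ^ (-p)` with `p > 0`, which lies above its tangent line at the
constant value `y₀` that `g` takes on the circle of radius `R`. What remains is to bound `∫ g` above
in terms of the Dirichlet energy `K` of one particle.

For a zero mean choreography, `q i - q j` is a time shift difference, and Parseval with `|sin (l x)|
≤ |l| |sin x|` gives `∫ ‖q i - q j‖² ≤ chordSq (i - j) * K` (`IsPeriodicH1.integral_shift_le`). For
a center `c`, zero mean and Wirtinger's inequality give `∫ ‖q i - c‖² ≤ K + 2π`. Both bounds are
affine in `K` and sharp on the circle, so the lower bound for the action is affine in `K`;
`IsBalancedRadius` says that its slope vanishes. Hence the action is `circularAction` plus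
nonnegative defects (`action_eq_circularAction_add`).

At a minimizer the defects of particle `0` with both centers vanish. Strict convexity then fixes its
distances to the two centers, which puts it on the circle of radius `R` in the plane `x = 0`, and
equality in Wirtinger leaves only the frequencies `±1` (`isUniformCircularMotion_of_action_le`).

The symmetry group enters only through the inclusion of `fixedLoops` in `choreographyLoops` and the
membership of circular motions in `fixedLoops`. The equations of motion are verified by computing
the forces. -/

noncomputable section

/-! ### Fourier series of scalar loops: shift inequality and Wirtinger's inequality -/

/-- A real `2π`-periodic function of class `H¹`. -/
structure IsScalarH1 (f : ℝ → ℝ) : Prop where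
  periodic : Function.Periodic f (2 * Real.pi)
  absolutelyContinuous : AbsolutelyContinuousOnInterval f 0 (2 * Real.pi)
  memLp_deriv : MemLp (deriv f) 2 (volume.restrict (Set.Ioc 0 (2 * Real.pi)))

/-- The Fourier coefficients of a function on `(0, 2π]`. -/
def circleCoeff (f : ℝ → ℝ) (l : ℤ) : ℂ :=
  fourierCoeffOn Real.two_pi_pos (fun t => (f t : ℂ)) l

lemma circleCoeff_eq (f : ℝ → ℝ) (l : ℤ) :
    circleCoeff f l = (1 / (2 * Real.pi) : ℝ) •
      ∫ t in (0 : ℝ)..(2 * Real.pi), Complex.exp (-(l * t * Complex.I)) * (f t : ℂ) := by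
  rw [circleCoeff, fourierCoeffOn_eq_integral, sub_zero]
  congr 1
  apply intervalIntegral.integral_congr
  intro t _
  simp only [fourier_coe_apply, smul_eq_mul]
  congr 2
  have : (Real.pi : ℂ) ≠ 0 := by exact_mod_cast Real.pi_ne_zero
  push_cast
  field_simp

lemma hasSum_circleCoeff {f : ℝ → ℝ}
    (hf : MemLp f 2 (volume.restrict (Set.Ioc 0 (2 * Real.pi)))) :
    HasSum (fun l => ‖circleCoeff f l‖ ^ 2)
      ((2 * Real.pi)⁻¹ * ∫ t in (0 : ℝ)..(2 * Real.pi), f t ^ 2) := by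
  have := hasSum_sq_fourierCoeffOn Real.two_pi_pos
    (f := fun t => (f t : ℂ)) (MemLp.ofReal hf)
  simpa [circleCoeff] using this

lemma continuous_of_periodic_of_continuousOn {E : Type*} [TopologicalSpace E] {f : ℝ → E}
    (hp : Function.Periodic f (2 * Real.pi))
    (hc : ContinuousOn f (Set.Icc 0 (2 * Real.pi))) : Continuous f := by
  have : Fact (0 < 2 * Real.pi) := ⟨Real.two_pi_pos⟩
  have h1 : Continuous (AddCircle.liftIco (2 * Real.pi) 0 f) := by
    apply AddCircle.liftIco_continuous
    · simp [show f (2 * Real.pi) = f 0 by simpa using hp 0]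
    · simpa using hc
  have h2 : f = fun t : ℝ => AddCircle.liftIco (2 * Real.pi) 0 f (t : AddCircle (2 * Real.pi)) := by
    funext t
    obtain ⟨y, hy, n, hn⟩ : ∃ y ∈ Set.Ico 0 (2 * Real.pi), ∃ n : ℤ, t = y + n * (2 * Real.pi) := by
      refine ⟨toIcoMod Real.two_pi_pos 0 t, by simpa using toIcoMod_mem_Ico Real.two_pi_pos 0 t,
        toIcoDiv Real.two_pi_pos 0 t, ?_⟩
      simp
    have e : (t : AddCircle (2 * Real.pi)) = (y : AddCircle (2 * Real.pi)) := by
      rw [hn, AddCircle.coe_add, ← zsmul_eq_mul, AddCircle.coe_zsmul, AddCircle.coe_period]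
      simp
    rw [e, AddCircle.liftIco_coe_apply (by simpa using hy), hn]
    exact hp.int_mul n y
  rw [h2]
  exact h1.comp (AddCircle.continuous_mk' _)

lemma IsScalarH1.continuous {f : ℝ → ℝ} (hf : IsScalarH1 f) : Continuous f := by
  apply continuous_of_periodic_of_continuousOn hf.periodic
  have := hf.absolutelyContinuous.continuousOn
  rwa [Set.uIcc_of_le Real.two_pi_pos.le] at this

lemma Continuous.memLp_Ioc {f : ℝ → ℝ} (hf : Continuous f) (a b : ℝ) :
    MemLp f 2 (volume.restrict (Set.Ioc a b)) := by
  obtain ⟨C, hC⟩ := isCompact_Icc.exists_bound_of_continuousOn (hf.continuousOn (s := Set.Icc a b))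
  refine MemLp.of_bound hf.aestronglyMeasurable C ?_
  filter_upwards [ae_restrict_mem measurableSet_Ioc] with x hx
  exact hC x (Set.Ioc_subset_Icc_self hx)

lemma exp_neg_int_mul (l : ℤ) (t : ℝ) : Complex.exp (-(l * t * Complex.I)) =
    (Real.cos (l * t) : ℂ) - (Real.sin (l * t) : ℂ) * Complex.I := by
  have : -((l : ℂ) * t * Complex.I) = ((-(l * t) : ℝ) : ℂ) * Complex.I := by push_cast; ring
  rw [this, Complex.exp_mul_I, ← Complex.ofReal_cos, ← Complex.ofReal_sin, Real.cos_neg,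
    Real.sin_neg]
  push_cast; ring

lemma integral_exp_mul_ofReal (l : ℤ) {f : ℝ → ℝ}
    (hf : IntervalIntegrable f volume 0 (2 * Real.pi)) :
    ∫ t in (0 : ℝ)..(2 * Real.pi), Complex.exp (-(l * t * Complex.I)) * (f t : ℂ) =
      ((∫ t in (0 : ℝ)..(2 * Real.pi), Real.cos (l * t) * f t : ℝ) : ℂ) -
      ((∫ t in (0 : ℝ)..(2 * Real.pi), Real.sin (l * t) * f t : ℝ) : ℂ) * Complex.I := by
  have hc : IntervalIntegrable (fun t => Real.cos (l * t) * f t) volume 0 (2 * Real.pi) :=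
    hf.continuousOn_mul (by fun_prop)
  have hs : IntervalIntegrable (fun t => Real.sin (l * t) * f t) volume 0 (2 * Real.pi) :=
    hf.continuousOn_mul (by fun_prop)
  have hc' : IntervalIntegrable (fun t => ((Real.cos (l * t) * f t : ℝ) : ℂ)) volume 0
      (2 * Real.pi) := intervalIntegrable_iff.2 (intervalIntegrable_iff.1 hc).ofReal
  have hs' : IntervalIntegrable (fun t => ((Real.sin (l * t) * f t : ℝ) : ℂ)) volume 0
      (2 * Real.pi) := intervalIntegrable_iff.2 (intervalIntegrable_iff.1 hs).ofReal
  rw [← intervalIntegral.integral_ofReal, ← intervalIntegral.integral_ofReal,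
    ← intervalIntegral.integral_mul_const, ← intervalIntegral.integral_sub]
  · apply intervalIntegral.integral_congr
    intro t _
    simp only [exp_neg_int_mul]
    push_cast; ring
  · exact hc'
  · exact hs'.mul_const _

/-- Integration by parts for absolutely continuous functions, applied to the cosine and sine parts
separately; periodicity cancels the boundary terms. -/
lemma IsScalarH1.circleCoeff_deriv {f : ℝ → ℝ} (hf : IsScalarH1 f) (l : ℤ) :
    circleCoeff (deriv f) l = l * Complex.I * circleCoeff f l := by
  have hc : ContDiff ℝ 1 (fun t : ℝ => Real.cos (l * t)) := by fun_prop
  have hs : ContDiff ℝ 1 (fun t : ℝ => Real.sin (l * t)) := by fun_prop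
  have dc : deriv (fun t : ℝ => Real.cos (l * t)) = fun t => -(l * Real.sin (l * t)) := by
    funext t
    simp [mul_comm]
  have ds : deriv (fun t : ℝ => Real.sin (l * t)) = fun t => l * Real.cos (l * t) := by
    funext t
    simp [mul_comm]
  have e0 : f (2 * Real.pi) = f 0 := by simpa using hf.periodic 0
  have i1 := hc.contDiffOn.absolutelyContinuousOnInterval.integral_mul_deriv_eq_deriv_mul
    hf.absolutelyContinuous
  have i2 := hs.contDiffOn.absolutelyContinuousOnInterval.integral_mul_deriv_eq_deriv_mul
    hf.absolutelyContinuous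
  rw [dc, e0] at i1
  rw [ds, e0] at i2
  simp only [mul_zero, Real.cos_zero, Real.sin_zero, Real.cos_int_mul_two_pi,
    (by simpa using Real.sin_add_int_mul_two_pi 0 l : Real.sin (l * (2 * Real.pi)) = 0)] at i1 i2
  simp only [neg_mul, mul_assoc, intervalIntegral.integral_neg,
    intervalIntegral.integral_const_mul] at i1 i2
  rw [circleCoeff_eq, circleCoeff_eq, integral_exp_mul_ofReal _
    hf.absolutelyContinuous.intervalIntegrable_deriv, integral_exp_mul_ofReal _
    (hf.continuous.intervalIntegrable _ _), i1, i2]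
  simp only [Complex.real_smul]
  push_cast
  linear_combination ((1 / (2 * Real.pi : ℂ)) * l * ((∫ t in (0 : ℝ)..(2 * Real.pi), Real.sin (l * t) * f t : ℝ) : ℂ)) * Complex.I_sq

lemma IsScalarH1.circleCoeff_shift {f : ℝ → ℝ} (hf : IsScalarH1 f) (a : ℝ) (l : ℤ) :
    circleCoeff (fun t => f (t + a)) l = Complex.exp (l * a * Complex.I) * circleCoeff f l := by
  rw [circleCoeff_eq, circleCoeff_eq, mul_smul_comm]
  congr 1
  let F : ℝ → ℂ := fun t => Complex.exp (-(l * t * Complex.I)) * (f t : ℂ)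
  have hF : Function.Periodic F (2 * Real.pi) := by
    intro t
    simp only [F, hf.periodic t]
    congr 1
    rw [Complex.exp_eq_exp_iff_exists_int]
    exact ⟨-l, by push_cast; ring⟩
  have h1 := hF.intervalIntegral_add_eq a 0
  have h2 := intervalIntegral.integral_comp_add_right (a := 0) (b := 2 * Real.pi) F a
  rw [zero_add, add_comm (2 * Real.pi) a, h1, zero_add] at h2
  rw [← h2, ← intervalIntegral.integral_const_mul]
  apply intervalIntegral.integral_congr
  intro t _
  simp only [F]
  rw [← mul_assoc, ← Complex.exp_add]
  congr 2
  push_cast; ring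

lemma circleCoeff_sub {f g : ℝ → ℝ} (hf : Continuous f) (hg : Continuous g) (l : ℤ) :
    circleCoeff (fun t => f t - g t) l = circleCoeff f l - circleCoeff g l := by
  rw [circleCoeff_eq, circleCoeff_eq, circleCoeff_eq, ← smul_sub,
    ← intervalIntegral.integral_sub]
  · congr 1
    apply intervalIntegral.integral_congr
    intro t _
    simp only; push_cast; ring
  · apply Continuous.intervalIntegrable; fun_prop
  · apply Continuous.intervalIntegrable; fun_prop

lemma IsScalarH1.hasSum {f : ℝ → ℝ} (hf : IsScalarH1 f) :
    HasSum (fun l => ‖circleCoeff f l‖ ^ 2)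
      ((2 * Real.pi)⁻¹ * ∫ t in (0 : ℝ)..(2 * Real.pi), f t ^ 2) :=
  hasSum_circleCoeff (hf.continuous.memLp_Ioc _ _)

lemma IsScalarH1.hasSum_deriv {f : ℝ → ℝ} (hf : IsScalarH1 f) :
    HasSum (fun l : ℤ => (l : ℝ) ^ 2 * ‖circleCoeff f l‖ ^ 2)
      ((2 * Real.pi)⁻¹ * ∫ t in (0 : ℝ)..(2 * Real.pi), deriv f t ^ 2) := by
  have := hasSum_circleCoeff hf.memLp_deriv
  simpa [hf.circleCoeff_deriv, mul_pow] using this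

lemma norm_exp_sub_one_sq (x : ℝ) :
    ‖Complex.exp (x * Complex.I) - 1‖ ^ 2 = 4 * Real.sin (x / 2) ^ 2 := by
  rw [Complex.exp_mul_I, ← Complex.ofReal_cos, ← Complex.ofReal_sin, Complex.sq_norm,
    Complex.normSq_apply]
  simp [-Complex.ofReal_cos, -Complex.ofReal_sin]
  have h1 : Real.cos x = 1 - 2 * Real.sin (x / 2) ^ 2 := by
    have := Real.cos_two_mul (x / 2)
    have h2 := Real.sin_sq_add_cos_sq (x / 2)
    rw [mul_div_cancel₀ _ two_ne_zero] at this
    linarith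
  have h2 := Real.sin_sq_add_cos_sq x
  nlinarith

/-- Parseval for `f (t + a) - f t`, whose coefficients are those of `f` times `exp (l a I) - 1`. -/
lemma IsScalarH1.hasSum_shift {f : ℝ → ℝ} (hf : IsScalarH1 f) (a : ℝ) :
    HasSum (fun l : ℤ => 4 * Real.sin (l * (a / 2)) ^ 2 * ‖circleCoeff f l‖ ^ 2)
      ((2 * Real.pi)⁻¹ * ∫ t in (0 : ℝ)..(2 * Real.pi), (f (t + a) - f t) ^ 2) := by
  have hc := hf.continuous
  have := hasSum_circleCoeff (f := fun t => f (t + a) - f t)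
    (Continuous.memLp_Ioc (by fun_prop) _ _)
  convert this using 2 with l
  rw [circleCoeff_sub (by fun_prop) hc, hf.circleCoeff_shift]
  have : Complex.exp (l * a * Complex.I) * circleCoeff f l - circleCoeff f l =
    (Complex.exp (((l * a : ℝ) : ℂ) * Complex.I) - 1) * circleCoeff f l := by push_cast; ring
  rw [this, norm_mul, mul_pow, norm_exp_sub_one_sq, mul_div_assoc]

lemma abs_sin_nat_mul_le (n : ℕ) (x : ℝ) : |Real.sin (n * x)| ≤ n * |Real.sin x| := by
  induction n with
  | zero => simp
  | succ k ih =>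
    push_cast
    rw [add_mul, one_mul, Real.sin_add]
    calc _ ≤ |Real.sin (k * x) * Real.cos x| + |Real.cos (k * x) * Real.sin x| := abs_add_le _ _
      _ ≤ |Real.sin (k * x)| * 1 + 1 * |Real.sin x| := by
        rw [abs_mul, abs_mul]
        gcongr
        · exact Real.abs_cos_le_one x
        · exact Real.abs_cos_le_one _
      _ ≤ _ := by linarith

lemma sin_int_mul_sq_le (l : ℤ) (x : ℝ) :
    Real.sin (l * x) ^ 2 ≤ (l : ℝ) ^ 2 * Real.sin x ^ 2 := by
  have h : |Real.sin (l * x)| ≤ |(l : ℝ)| * |Real.sin x| := by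
    obtain ⟨n, rfl | rfl⟩ := l.eq_nat_or_neg
    · simpa using abs_sin_nat_mul_le n x
    · simpa using abs_sin_nat_mul_le n x
  rw [← sq_abs, ← sq_abs (l : ℝ), ← sq_abs (Real.sin x), ← mul_pow]
  gcongr

/-- The two Parseval series compare term by term, with equality at `l = ±1`, so the constant is
sharp on circular motions. The mean plays no role, since the term `l = 0` vanishes on both sides. -/
lemma IsScalarH1.integral_shift_le {f : ℝ → ℝ} (hf : IsScalarH1 f) (a : ℝ) :
    ∫ t in (0 : ℝ)..(2 * Real.pi), (f (t + a) - f t) ^ 2 ≤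
      4 * Real.sin (a / 2) ^ 2 * ∫ t in (0 : ℝ)..(2 * Real.pi), deriv f t ^ 2 := by
  have h := hasSum_le (fun l => ?_) (hf.hasSum_shift a)
    (hf.hasSum_deriv.mul_left (4 * Real.sin (a / 2) ^ 2))
  · rw [mul_left_comm] at h
    exact le_of_mul_le_mul_left h (inv_pos.2 Real.two_pi_pos)
  · rw [← mul_assoc]
    gcongr ?_ * _
    nlinarith [sin_int_mul_sq_le l (a / 2)]

lemma circleCoeff_zero {f : ℝ → ℝ} (hf : ∫ t in (0 : ℝ)..(2 * Real.pi), f t = 0) :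
    circleCoeff f 0 = 0 := by
  rw [circleCoeff_eq]
  simp [intervalIntegral.integral_ofReal, hf]

lemma IsScalarH1.wirtinger_aux {f : ℝ → ℝ} (hmean : ∫ t in (0 : ℝ)..(2 * Real.pi), f t = 0)
    (l : ℤ) : ‖circleCoeff f l‖ ^ 2 ≤ (l : ℝ) ^ 2 * ‖circleCoeff f l‖ ^ 2 := by
  rcases eq_or_ne l 0 with rfl | hl
  · simp [circleCoeff_zero hmean]
  · have : (1 : ℝ) ≤ (l : ℝ) ^ 2 := by
      have := Int.one_le_abs hl
      rw [← sq_abs]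
      have h' : (1 : ℝ) ≤ |(l : ℝ)| := by exact_mod_cast this
      nlinarith
    nlinarith [sq_nonneg ‖circleCoeff f l‖]

/-- Wirtinger's inequality. -/
lemma IsScalarH1.wirtinger {f : ℝ → ℝ} (hf : IsScalarH1 f)
    (hmean : ∫ t in (0 : ℝ)..(2 * Real.pi), f t = 0) :
    ∫ t in (0 : ℝ)..(2 * Real.pi), f t ^ 2 ≤ ∫ t in (0 : ℝ)..(2 * Real.pi), deriv f t ^ 2 :=
  le_of_mul_le_mul_left (hasSum_le (IsScalarH1.wirtinger_aux hmean) hf.hasSum hf.hasSum_deriv)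
    (inv_pos.2 Real.two_pi_pos)

/-- The equality case of Wirtinger's inequality. -/
lemma IsScalarH1.eq_cos_sin_of_wirtinger_eq {f : ℝ → ℝ} (hf : IsScalarH1 f)
    (hmean : ∫ t in (0 : ℝ)..(2 * Real.pi), f t = 0)
    (heq : ∫ t in (0 : ℝ)..(2 * Real.pi), f t ^ 2 =
      ∫ t in (0 : ℝ)..(2 * Real.pi), deriv f t ^ 2) :
    ∃ a b : ℝ, ∀ t, f t = a * Real.cos t + b * Real.sin t := by
  -- The difference of the two Parseval series has nonnegative terms and sum zero, so `(l² - 1)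
  -- ‖circleCoeff f l‖² = 0` for every `l`.
  have hz : ∀ l : ℤ, l ∉ ({1, -1} : Finset ℤ) → circleCoeff f l = 0 := by
    intro l hl
    rcases eq_or_ne l 0 with rfl | hl0
    · exact circleCoeff_zero hmean
    have h := hf.hasSum_deriv.sub hf.hasSum
    rw [heq, sub_self, hasSum_zero_iff_of_nonneg
      (fun l => sub_nonneg.2 (IsScalarH1.wirtinger_aux hmean l))] at h
    have h1 := congrFun h l
    simp only [Pi.zero_apply] at h1
    have h2 : (l : ℝ) ^ 2 - 1 ≠ 0 := by
      have : (l : ℝ) ^ 2 ≠ 1 := by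
        rw [Ne, sq_eq_one_iff]
        simp at hl
        exact_mod_cast not_or.2 hl
      exact sub_ne_zero.2 this
    have h3 : ((l : ℝ) ^ 2 - 1) * ‖circleCoeff f l‖ ^ 2 = 0 := by linarith
    simpa [h2] using h3
  have : Fact (0 < 2 * Real.pi) := ⟨Real.two_pi_pos⟩
  have hp : Function.Periodic (fun t => (f t : ℂ)) (2 * Real.pi) := fun t => by
    simp only [hf.periodic t]
  let F : C(AddCircle (2 * Real.pi), ℂ) := ⟨hp.lift,
    continuous_coinduced_dom.2 (Complex.continuous_ofReal.comp hf.continuous)⟩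
  have hF : ∀ t : ℝ, F (t : AddCircle (2 * Real.pi)) = (f t : ℂ) := fun t => rfl
  have hFc : ∀ l, fourierCoeff F l = circleCoeff f l := by
    intro l
    rw [fourierCoeff_eq_intervalIntegral _ _ 0, circleCoeff_eq, zero_add]
    congr 1
    apply intervalIntegral.integral_congr
    intro t _
    simp only [fourier_coe_apply, smul_eq_mul, hF]
    congr 2
    have : (Real.pi : ℂ) ≠ 0 := by exact_mod_cast Real.pi_ne_zero
    push_cast
    field_simp
  -- With finitely many nonzero coefficients the Fourier series of the continuous `F` represents it
  -- at every point, not only almost everywhere.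
  have hsum : Summable (fourierCoeff F) :=
    summable_of_ne_finset_zero (s := {1, -1}) (fun l hl => by rw [hFc, hz l hl])
  refine ⟨(circleCoeff f 1 + circleCoeff f (-1)).re, (circleCoeff f (-1) - circleCoeff f 1).im,
    fun t => ?_⟩
  have h1 := has_pointwise_sum_fourier_series_of_summable hsum (t : AddCircle (2 * Real.pi))
  have h2 := hasSum_sum_of_ne_finset_zero (L := SummationFilter.unconditional ℤ) (f := fun l => fourierCoeff F l •
    (fourier l (t : AddCircle (2 * Real.pi)) : ℂ)) (s := {1, -1})
    (fun l hl => by rw [hFc, hz l hl, zero_smul])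
  have h3 := h1.unique h2
  rw [Finset.sum_pair (by norm_num), hF, hFc, hFc] at h3
  have e : ∀ l : ℤ, (fourier l (t : AddCircle (2 * Real.pi)) : ℂ) =
      (Real.cos (l * t) : ℂ) + (Real.sin (l * t) : ℂ) * Complex.I := by
    intro l
    have : (Real.pi : ℂ) ≠ 0 := by exact_mod_cast Real.pi_ne_zero
    rw [fourier_coe_apply, Complex.ofReal_cos, Complex.ofReal_sin, ← Complex.exp_mul_I]
    congr 1
    push_cast
    field_simp
  rw [e, e] at h3
  have h4 := congrArg Complex.re h3
  simp [-Complex.ofReal_cos, -Complex.ofReal_sin] at h4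
  rw [h4]
  simp
  ring

/-! ### Loops in space, coordinate by coordinate -/

lemma IsPeriodicH1.continuous {x : ℝ → Space3} (hx : IsPeriodicH1 x) : Continuous x := by
  apply continuous_of_periodic_of_continuousOn hx.periodic
  have := hx.absolutelyContinuous.continuousOn
  rwa [Set.uIcc_of_le Real.two_pi_pos.le] at this

lemma IsPeriodicH1.absolutelyContinuous_apply {x : ℝ → Space3} (hx : IsPeriodicH1 x) (k : Fin 3) :
    AbsolutelyContinuousOnInterval (fun t => x t k) 0 (2 * Real.pi) := by
  have h := hx.absolutelyContinuous
  rw [absolutelyContinuousOnInterval_iff] at h ⊢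
  intro ε hε
  obtain ⟨δ, hδ, h⟩ := h ε hε
  refine ⟨δ, hδ, fun E hE hE' => lt_of_le_of_lt (Finset.sum_le_sum fun i _ => ?_) (h E hE hE')⟩
  rw [dist_eq_norm, dist_eq_norm, ← PiLp.sub_apply]
  exact PiLp.norm_apply_le _ _

lemma IsPeriodicH1.ae_differentiableAt {x : ℝ → Space3} (hx : IsPeriodicH1 x) :
    ∀ᵐ t, t ∈ Set.uIcc 0 (2 * Real.pi) → DifferentiableAt ℝ x t := by
  have h := fun k => (hx.absolutelyContinuous_apply k).ae_differentiableAt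
  rw [← ae_all_iff] at h
  filter_upwards [h] with t ht ht'
  exact differentiableAt_euclidean.2 fun k => ht k ht'

lemma deriv_euclidean_apply {x : ℝ → Space3} {t : ℝ} (h : DifferentiableAt ℝ x t) (k : Fin 3) :
    deriv (fun s => x s k) t = deriv x t k := by
  have h1 := (PiLp.proj 2 (𝕜 := ℝ) (fun _ : Fin 3 => ℝ) k).hasFDerivAt.comp_hasDerivAt t h.hasDerivAt
  exact h1.deriv

/-- Only almost everywhere: where `x` is not differentiable, `deriv x` is the default `0`, although
a single coordinate may still have a derivative. -/
lemma IsPeriodicH1.deriv_apply_ae {x : ℝ → Space3} (hx : IsPeriodicH1 x) :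
    ∀ᵐ t ∂(volume.restrict (Set.Ioc 0 (2 * Real.pi))), ∀ k,
      deriv (fun s => x s k) t = deriv x t k := by
  filter_upwards [ae_restrict_of_ae hx.ae_differentiableAt, ae_restrict_mem measurableSet_Ioc]
    with t ht ht' k
  refine deriv_euclidean_apply (ht ?_) k
  rw [Set.uIcc_of_le Real.two_pi_pos.le]
  exact Set.Ioc_subset_Icc_self ht'

lemma IsPeriodicH1.isScalarH1 {x : ℝ → Space3} (hx : IsPeriodicH1 x) (k : Fin 3) :
    IsScalarH1 (fun t => x t k) where
  periodic t := by simp only [hx.periodic t]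
  absolutelyContinuous := hx.absolutelyContinuous_apply k
  memLp_deriv := by
    have h1 : MemLp (fun t => deriv x t k) 2 (volume.restrict (Set.Ioc 0 (2 * Real.pi))) :=
      (PiLp.proj 2 (𝕜 := ℝ) (fun _ : Fin 3 => ℝ) k).comp_memLp' hx.memLp_deriv
    refine h1.ae_eq ?_
    filter_upwards [hx.deriv_apply_ae] with t ht
    exact (ht k).symm

lemma IsScalarH1.intervalIntegrable_deriv_sq {f : ℝ → ℝ} (hf : IsScalarH1 f) :
    IntervalIntegrable (fun t => deriv f t ^ 2) volume 0 (2 * Real.pi) := by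
  rw [intervalIntegrable_iff, Set.uIoc_of_le Real.two_pi_pos.le]
  exact hf.memLp_deriv.integrable_sq

lemma IsPeriodicH1.intervalIntegrable_deriv_sq {x : ℝ → Space3} (hx : IsPeriodicH1 x) :
    IntervalIntegrable (fun t => ‖deriv x t‖ ^ 2) volume 0 (2 * Real.pi) := by
  rw [intervalIntegrable_iff, Set.uIoc_of_le Real.two_pi_pos.le]
  exact hx.memLp_deriv.norm.integrable_sq

/-- The integral of the squared speed. -/
def dirichletEnergy (x : ℝ → Space3) : ℝ := ∫ t in (0 : ℝ)..(2 * Real.pi), ‖deriv x t‖ ^ 2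

lemma IsPeriodicH1.dirichletEnergy_eq {x : ℝ → Space3} (hx : IsPeriodicH1 x) :
    dirichletEnergy x =
      ∑ k, ∫ t in (0 : ℝ)..(2 * Real.pi), deriv (fun s => x s k) t ^ 2 := by
  rw [dirichletEnergy, ← intervalIntegral.integral_finsetSum
    (fun k _ => (hx.isScalarH1 k).intervalIntegrable_deriv_sq)]
  apply intervalIntegral.integral_congr_ae_restrict
  rw [Set.uIoc_of_le Real.two_pi_pos.le]
  filter_upwards [hx.deriv_apply_ae] with t ht
  simp [ht, EuclideanSpace.real_norm_sq_eq]

lemma integral_norm_sq_eq {x : ℝ → Space3} (hx : Continuous x) :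
    ∫ t in (0 : ℝ)..(2 * Real.pi), ‖x t‖ ^ 2 =
      ∑ k, ∫ t in (0 : ℝ)..(2 * Real.pi), x t k ^ 2 := by
  rw [← intervalIntegral.integral_finsetSum
    (fun k _ => Continuous.intervalIntegrable (by fun_prop) _ _)]
  simp [EuclideanSpace.real_norm_sq_eq]

lemma integral_apply {x : ℝ → Space3} (hx : Continuous x) (k : Fin 3) :
    ∫ t in (0 : ℝ)..(2 * Real.pi), x t k = (∫ t in (0 : ℝ)..(2 * Real.pi), x t) k :=
  (PiLp.proj 2 (𝕜 := ℝ) (fun _ : Fin 3 => ℝ) k).intervalIntegral_comp_comm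
    (hx.intervalIntegrable _ _)

lemma IsPeriodicH1.integral_shift_le {x : ℝ → Space3} (hx : IsPeriodicH1 x) (a : ℝ) :
    ∫ t in (0 : ℝ)..(2 * Real.pi), ‖x (t + a) - x t‖ ^ 2 ≤
      4 * Real.sin (a / 2) ^ 2 * dirichletEnergy x := by
  have hc := hx.continuous
  rw [hx.dirichletEnergy_eq, integral_norm_sq_eq (by fun_prop), Finset.mul_sum]
  exact Finset.sum_le_sum fun k _ => (hx.isScalarH1 k).integral_shift_le a

lemma IsPeriodicH1.wirtinger {x : ℝ → Space3} (hx : IsPeriodicH1 x)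
    (hmean : ∫ t in (0 : ℝ)..(2 * Real.pi), x t = 0) :
    ∫ t in (0 : ℝ)..(2 * Real.pi), ‖x t‖ ^ 2 ≤ dirichletEnergy x := by
  rw [hx.dirichletEnergy_eq, integral_norm_sq_eq hx.continuous]
  exact Finset.sum_le_sum fun k _ => (hx.isScalarH1 k).wirtinger
    (by rw [integral_apply hx.continuous, hmean]; rfl)

lemma IsPeriodicH1.eq_cos_sin_of_wirtinger_eq {x : ℝ → Space3} (hx : IsPeriodicH1 x)
    (hmean : ∫ t in (0 : ℝ)..(2 * Real.pi), x t = 0)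
    (heq : ∫ t in (0 : ℝ)..(2 * Real.pi), ‖x t‖ ^ 2 = dirichletEnergy x) :
    ∃ a b : Space3, ∀ t, x t = Real.cos t • a + Real.sin t • b := by
  have hm : ∀ k, ∫ t in (0 : ℝ)..(2 * Real.pi), x t k = 0 := fun k => by
    rw [integral_apply hx.continuous, hmean]; rfl
  rw [hx.dirichletEnergy_eq, integral_norm_sq_eq hx.continuous] at heq
  have h := (Finset.sum_eq_sum_iff_of_le
    (fun k _ => (hx.isScalarH1 k).wirtinger (hm k))).1 heq
  choose a b hab using fun k => (hx.isScalarH1 k).eq_cos_sin_of_wirtinger_eq (hm k)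
    (h k (Finset.mem_univ k))
  refine ⟨WithLp.toLp 2 a, WithLp.toLp 2 b, fun t => ?_⟩
  ext k
  simp [hab k t, mul_comm]

/-! ### Tangent line bound for negative powers -/

/-- Strict convexity. By homogeneity only `r = y / y₀` matters, and `exp (-p log r) ≥ 1 - p log r >
1 - p (r - 1)`. -/
lemma Real.rpow_neg_tangent_lt {p y y₀ : ℝ} (hp : 0 < p) (hy : 0 < y) (hy₀ : 0 < y₀)
    (hne : y ≠ y₀) : y₀ ^ (-p) - p * y₀ ^ (-p - 1) * (y - y₀) < y ^ (-p) := by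
  set r := y / y₀ with hr
  have hr0 : 0 < r := div_pos hy hy₀
  have hr1 : r ≠ 1 := fun h => hne (by rw [hr, div_eq_one_iff_eq hy₀.ne'] at h; exact h)
  have e1 : y = y₀ * r := by rw [hr]; field_simp
  have h1 : 1 - p * (r - 1) < r ^ (-p) := by
    rw [Real.rpow_def_of_pos hr0]
    have h2 := Real.log_lt_sub_one_of_pos hr0 hr1
    have h3 := Real.add_one_le_exp (Real.log r * -p)
    nlinarith
  rw [e1, Real.mul_rpow hy₀.le hr0.le, Real.rpow_sub_one hy₀.ne']
  have h4 : 0 < y₀ ^ (-p) := Real.rpow_pos_of_pos hy₀ _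
  calc _ = y₀ ^ (-p) * (1 - p * (r - 1)) := by field_simp
    _ < _ := mul_lt_mul_of_pos_left h1 h4

lemma Real.rpow_neg_tangent_le {p y y₀ : ℝ} (hp : 0 < p) (hy : 0 < y) (hy₀ : 0 < y₀) :
    y₀ ^ (-p) - p * y₀ ^ (-p - 1) * (y - y₀) ≤ y ^ (-p) := by
  rcases eq_or_ne y y₀ with rfl | h
  · simp
  · exact (Real.rpow_neg_tangent_lt hp hy hy₀ h).le

/-- The excess of the integral of `g ^ (-p)` over its tangent lower bound at `y₀`, when the integral
of `g` is replaced by an upper bound `B`. -/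
def tangentDefect (p y₀ B : ℝ) (g : ℝ → ℝ) : ℝ :=
  (∫ t in (0 : ℝ)..(2 * Real.pi), g t ^ (-p)) -
    (2 * Real.pi * y₀ ^ (-p) - p * y₀ ^ (-p - 1) * (B - 2 * Real.pi * y₀))

section tangentDefect

variable {p y₀ B : ℝ} {g : ℝ → ℝ}

lemma integral_tangent (hg : Continuous g) :
    ∫ t in (0 : ℝ)..(2 * Real.pi), (y₀ ^ (-p) - p * y₀ ^ (-p - 1) * (g t - y₀)) =
      2 * Real.pi * y₀ ^ (-p) - p * y₀ ^ (-p - 1) *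
        ((∫ t in (0 : ℝ)..(2 * Real.pi), g t) - 2 * Real.pi * y₀) := by
  rw [intervalIntegral.integral_sub, intervalIntegral.integral_const_mul,
    intervalIntegral.integral_sub]
  · simp
  · exact hg.intervalIntegrable _ _
  · simp
  · simp
  · exact Continuous.intervalIntegrable (by fun_prop) _ _

lemma continuous_rpow_neg (hg : Continuous g) (hpos : ∀ t, 0 < g t) :
    Continuous (fun t => g t ^ (-p)) :=
  hg.rpow_const fun t => Or.inl (hpos t).ne'

lemma integral_tangent_le (hp : 0 < p) (hy₀ : 0 < y₀) (hg : Continuous g)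
    (hpos : ∀ t, 0 < g t) :
    2 * Real.pi * y₀ ^ (-p) - p * y₀ ^ (-p - 1) *
        ((∫ t in (0 : ℝ)..(2 * Real.pi), g t) - 2 * Real.pi * y₀) ≤
      ∫ t in (0 : ℝ)..(2 * Real.pi), g t ^ (-p) := by
  rw [← integral_tangent hg]
  apply intervalIntegral.integral_mono_on Real.two_pi_pos.le
  · exact Continuous.intervalIntegrable (by fun_prop) _ _
  · exact (continuous_rpow_neg hg hpos).intervalIntegrable _ _
  · exact fun t _ => Real.rpow_neg_tangent_le hp (hpos t) hy₀

lemma tangentDefect_nonneg (hp : 0 < p) (hy₀ : 0 < y₀) (hg : Continuous g)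
    (hpos : ∀ t, 0 < g t) (hB : ∫ t in (0 : ℝ)..(2 * Real.pi), g t ≤ B) :
    0 ≤ tangentDefect p y₀ B g := by
  have h := integral_tangent_le hp hy₀ hg hpos
  have h1 : 0 < p * y₀ ^ (-p - 1) := mul_pos hp (Real.rpow_pos_of_pos hy₀ _)
  have h2 := mul_le_mul_of_nonneg_left hB h1.le
  rw [tangentDefect]
  linarith

/-- The defect adds two nonnegative losses, one from the tangent line and one from replacing `∫ g`
by `B`. The first vanishes only if `g` is constantly `y₀`, by strictness and continuity; the second
forces equality because the slope is nonzero. -/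
lemma tangentDefect_eq_zero (hp : 0 < p) (hy₀ : 0 < y₀) (hg : Continuous g)
    (hpos : ∀ t, 0 < g t) (hB : ∫ t in (0 : ℝ)..(2 * Real.pi), g t ≤ B)
    (h0 : tangentDefect p y₀ B g = 0) :
    (∀ t ∈ Set.Icc 0 (2 * Real.pi), g t = y₀) ∧ ∫ t in (0 : ℝ)..(2 * Real.pi), g t = B := by
  have h := integral_tangent_le hp hy₀ hg hpos
  have h1 : 0 < p * y₀ ^ (-p - 1) := mul_pos hp (Real.rpow_pos_of_pos hy₀ _)
  have h2 := mul_le_mul_of_nonneg_left hB h1.le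
  rw [tangentDefect] at h0
  refine ⟨fun t ht => ?_, ?_⟩
  · by_contra hne
    have h3 := intervalIntegral.integral_lt_integral_of_continuousOn_of_le_of_exists_lt
      (f := fun t => y₀ ^ (-p) - p * y₀ ^ (-p - 1) * (g t - y₀)) (g := fun t => g t ^ (-p))
      Real.two_pi_pos (by fun_prop) (continuous_rpow_neg hg hpos).continuousOn
      (fun t _ => Real.rpow_neg_tangent_le hp (hpos t) hy₀)
      ⟨t, ht, Real.rpow_neg_tangent_lt hp (hpos t) hy₀ hne⟩
    rw [integral_tangent hg] at h3
    linarith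
  · exact le_antisymm hB (le_of_mul_le_mul_left (by linarith) h1)

lemma tangentDefect_of_const (h : ∀ t, g t = y₀) :
    tangentDefect p y₀ (2 * Real.pi * y₀) g = 0 := by
  simp [tangentDefect, h]

end tangentDefect

/-! ### Chords of the regular polygon and the balanced radius -/

section polygon

variable {n : ℕ} [NeZero n]

/-- The phase of the `k`-th vertex of the regular `n`-gon. -/
def phase (k : Fin n) : ℝ := (k : ℕ) * (2 * Real.pi / n)

lemma phase_zero : phase (0 : Fin n) = 0 := by simp [phase]

/-- Subtraction in `Fin n` wraps around modulo `n`, so phases subtract only modulo `2π`. -/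
lemma phase_sub (i j : Fin n) : ∃ z : ℤ, phase (i - j) = phase i - phase j + z * (2 * Real.pi) := by
  have hn : (n : ℝ) ≠ 0 := by exact_mod_cast NeZero.ne n
  have h1 := Nat.div_add_mod (n - j.val + i.val) n
  have h2 : (n - j.val : ℕ) + j.val = n := Nat.sub_add_cancel j.isLt.le
  refine ⟨1 - ((n - j.val + i.val) / n : ℕ), ?_⟩
  rw [phase, phase, phase, Fin.val_sub]
  have h3 : (n : ℝ) * ((n - j.val + i.val) / n : ℕ) + ((n - j.val + i.val) % n : ℕ) =
      (n - j.val : ℕ) + i.val := by exact_mod_cast h1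
  have h4 : ((n - j.val : ℕ) : ℝ) + j.val = n := by exact_mod_cast h2
  generalize (n - j.val + i.val) / n = z at h3 ⊢
  push_cast
  field_simp
  linarith

lemma cos_phase_sub (i j : Fin n) : Real.cos (phase (i - j)) = Real.cos (phase i - phase j) := by
  obtain ⟨z, hz⟩ := phase_sub i j
  rw [hz, Real.cos_add_int_mul_two_pi]

lemma sin_phase_sub (i j : Fin n) : Real.sin (phase (i - j)) = Real.sin (phase i - phase j) := by
  obtain ⟨z, hz⟩ := phase_sub i j
  rw [hz, Real.sin_add_int_mul_two_pi]

/-- The squared length of the chord between vertices at distance `k` of the regular `n`-gon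
inscribed in the unit circle. -/
def chordSq (k : Fin n) : ℝ := 2 - 2 * Real.cos (phase k)

lemma chordSq_sub (i j : Fin n) : chordSq (i - j) = 2 - 2 * Real.cos (phase i - phase j) := by
  rw [chordSq, cos_phase_sub]

lemma chordSq_neg (k : Fin n) : chordSq (-k) = chordSq k := by
  rw [← zero_sub, chordSq_sub, phase_zero, zero_sub, Real.cos_neg, chordSq]

lemma chordSq_pos {k : Fin n} (hk : k ≠ 0) : 0 < chordSq k := by
  have hn : (0 : ℝ) < n := by exact_mod_cast NeZero.pos n
  have hk0 : (0 : ℝ) < (k : ℕ) := by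
    exact_mod_cast Nat.pos_of_ne_zero (fun h => hk (Fin.ext (by simpa using h)))
  have hkn : ((k : ℕ) : ℝ) < n := by exact_mod_cast k.isLt
  have h1 : 0 < phase k / 2 := by
    rw [phase]; have := Real.pi_pos; positivity
  have h2 : phase k / 2 < Real.pi := by
    rw [phase]
    calc _ = Real.pi * ((k : ℕ) / n) := by field_simp
      _ < Real.pi * 1 := mul_lt_mul_of_pos_left ((div_lt_one hn).2 hkn) Real.pi_pos
      _ = _ := mul_one _
  have h3 := Real.sin_pos_of_pos_of_lt_pi h1 h2
  have h4 := Real.cos_two_mul (phase k / 2)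
  have h5 := Real.sin_sq_add_cos_sq (phase k / 2)
  rw [mul_div_cancel₀ _ two_ne_zero] at h4
  rw [chordSq]
  nlinarith

lemma sum_compl_sub (F : Fin n → ℝ) (i : Fin n) :
    ∑ j ∈ ({i}ᶜ : Finset (Fin n)), F (i - j) = ∑ k ∈ ({0}ᶜ : Finset (Fin n)), F k := by
  refine Finset.sum_equiv (Equiv.subLeft i) (fun j => ?_) (fun j _ => rfl)
  simp [sub_eq_zero, eq_comm]

/-- For even `F`, the sum over all ordered pairs counts each unordered pair twice and gives the same
inner sum for each of the `n` indices. -/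
lemma sum_Ioi_sub (F : Fin n → ℝ) (hF : ∀ k, F (-k) = F k) :
    ∑ i : Fin n, ∑ j ∈ Finset.Ioi i, F (i - j) =
      n / 2 * ∑ k ∈ ({0}ᶜ : Finset (Fin n)), F k := by
  have h := Finset.sum_sum_Ioi_add_eq_sum_sum_off_diag (fun i j : Fin n => F (j - i))
  have e : ∀ i j : Fin n, F (j - i) = F (i - j) := fun i j => by rw [← neg_sub, hF]
  simp only [sum_compl_sub, Finset.sum_const, Finset.card_univ, Fintype.card_fin,
    nsmul_eq_mul] at h
  simp only [fun i j : Fin n => e i j, ← two_mul, ← Finset.mul_sum] at h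
  linarith

/-- The condition that gravitational attraction balances the centrifugal force for a uniformly
rotating `n`-gon of circumradius `R`. -/
def IsBalancedRadius (n : ℕ) [NeZero n] (α β m M R : ℝ) : Prop :=
  m = (∑ k ∈ ({0}ᶜ : Finset (Fin n)),
      m ^ 2 * (α / 2 * (chordSq k * R ^ 2) ^ (-(α / 2) - 1)) * chordSq k) +
    4 * (m * M) * (β / 2 * (1 + R ^ 2) ^ (-(β / 2) - 1))

/-- Intermediate value theorem in `r = R²`: the right-hand side `G` tends to `0` at infinity and is
at least `m` somewhere. -/
lemma exists_isBalancedRadius (hn : 2 ≤ n) {α β m M : ℝ} (hα : 0 < α) (hβ : 0 < β) (hm : 0 < m)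
    (hM : 0 < M) : ∃ R, 0 < R ∧ IsBalancedRadius n α β m M R := by
  let G : ℝ → ℝ := fun r => (∑ k ∈ ({0}ᶜ : Finset (Fin n)),
      m ^ 2 * (α / 2 * (chordSq k * r) ^ (-(α / 2) - 1)) * chordSq k) +
    4 * (m * M) * (β / 2 * (1 + r) ^ (-(β / 2) - 1))
  have hpos : ∀ k ∈ ({0}ᶜ : Finset (Fin n)), 0 < chordSq k := fun k hk =>
    chordSq_pos (by simpa using hk)
  have hG : ContinuousOn G (Set.Ioi 0) := by
    refine ContinuousOn.add (continuousOn_finsetSum _ fun k hk => ?_) ?_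
    · refine ContinuousOn.mul (continuousOn_const.mul (continuousOn_const.mul
        (ContinuousOn.rpow_const (by fun_prop) fun r hr => Or.inl ?_))) continuousOn_const
      exact (mul_pos (hpos k hk) hr).ne'
    · refine continuousOn_const.mul (continuousOn_const.mul
        (ContinuousOn.rpow_const (by fun_prop) fun r hr => Or.inl ?_))
      have : (0 : ℝ) < r := hr
      positivity
  have hlim : Filter.Tendsto G Filter.atTop (nhds 0) := by
    have h1 : ∀ k ∈ ({0}ᶜ : Finset (Fin n)), Filter.Tendsto
        (fun r => m ^ 2 * (α / 2 * (chordSq k * r) ^ (-(α / 2) - 1)) * chordSq k)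
        Filter.atTop (nhds 0) := fun k hk => by
      have := ((tendsto_rpow_neg_atTop (y := α / 2 + 1) (by positivity)).comp
        (Filter.tendsto_id.const_mul_atTop (hpos k hk)))
      have := ((this.const_mul (α / 2)).const_mul (m ^ 2)).mul_const (chordSq k)
      simp only [show -(α / 2) - 1 = -(α / 2 + 1) by ring]
      simpa [Function.comp_def, -neg_add_rev] using this
    have h2 : Filter.Tendsto (fun r : ℝ => 4 * (m * M) * (β / 2 * (1 + r) ^ (-(β / 2) - 1)))
        Filter.atTop (nhds 0) := by
      have := ((tendsto_rpow_neg_atTop (y := β / 2 + 1) (by positivity)).comp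
        (Filter.tendsto_atTop_add_const_left Filter.atTop (1 : ℝ) Filter.tendsto_id))
      have := ((this.const_mul (β / 2)).const_mul (4 * (m * M)))
      simp only [show -(β / 2) - 1 = -(β / 2 + 1) by ring]
      simpa [Function.comp_def, -neg_add_rev] using this
    simpa using (tendsto_finsetSum _ h1).add h2
  -- The term `k = 1`, present because `n ≥ 2`, can alone be made equal to `m`: `w` solves `c * w ^
  -- (-(α / 2) - 1) = m` and `r₁ = w / chordSq k₁`. The other terms are nonnegative.
  obtain ⟨r₁, hr₁, hG₁⟩ : ∃ r₁, 0 < r₁ ∧ m ≤ G r₁ := by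
    let k₁ : Fin n := ⟨1, hn⟩
    have hk₁ : k₁ ∈ ({0}ᶜ : Finset (Fin n)) := by
      simp [k₁, Fin.ext_iff]
    have hs := hpos k₁ hk₁
    set c := m ^ 2 * (α / 2) * chordSq k₁ with hc
    have hc0 : 0 < c := by positivity
    set w := (m / c) ^ (-(α / 2) - 1)⁻¹ with hw
    have hw0 : 0 < w := Real.rpow_pos_of_pos (by positivity) _
    refine ⟨w / chordSq k₁, by positivity, ?_⟩
    have e : chordSq k₁ * (w / chordSq k₁) = w := by field_simp
    have e2 : w ^ (-(α / 2) - 1) = m / c := by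
      rw [hw, ← Real.rpow_mul (by positivity), inv_mul_cancel₀ (by linarith), Real.rpow_one]
    have h1 : m = m ^ 2 * (α / 2 * (chordSq k₁ * (w / chordSq k₁)) ^ (-(α / 2) - 1)) *
        chordSq k₁ := by
      rw [e, e2, hc]; field_simp
    have h2 := Finset.single_le_sum (f := fun k : Fin n =>
      m ^ 2 * (α / 2 * (chordSq k * (w / chordSq k₁)) ^ (-(α / 2) - 1)) * chordSq k)
      (fun k hk => by have := hpos k hk; positivity) hk₁
    have h3 : 0 ≤ 4 * (m * M) * (β / 2 * (1 + w / chordSq k₁) ^ (-(β / 2) - 1)) := by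
      positivity
    simp only [G]
    linarith
  obtain ⟨r, hr, hGr⟩ := (isPreconnected_Ioi (a := (0 : ℝ))).intermediate_value_Ioc
    (l := Filter.atTop) (a := r₁) hr₁
    (Filter.le_principal_iff.2 (Filter.Ioi_mem_atTop 0)) hG hlim ⟨hm, hG₁⟩
  have hr' : 0 < r := hr
  refine ⟨Real.sqrt r, Real.sqrt_pos.2 hr', ?_⟩
  rw [IsBalancedRadius, Real.sq_sqrt hr'.le]
  exact hGr.symm

end polygon

/-! ### The action in terms of squared distances -/

lemma div_norm_rpow (c γ : ℝ) (d : Space3) : c / ‖d‖ ^ γ = c * (‖d‖ ^ 2) ^ (-(γ / 2)) := by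
  rw [div_eq_mul_inv, ← Real.rpow_natCast, ← Real.rpow_mul (norm_nonneg _), ← Real.rpow_neg
    (norm_nonneg _)]
  congr 2
  push_cast
  ring

lemma norm_sq_sub_center (x c : Space3) (hc : ‖c‖ = 1) :
    ‖x - c‖ ^ 2 = ‖x‖ ^ 2 - 2 * inner ℝ c x + 1 := by
  rw [norm_sub_sq_real, hc, real_inner_comm]; ring

lemma norm_centerOne : ‖centerOne‖ = 1 := by
  simp [centerOne, EuclideanSpace.norm_eq, Fin.sum_univ_three]

lemma norm_centerTwo : ‖centerTwo‖ = 1 := by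
  simp [centerTwo, EuclideanSpace.norm_eq, Fin.sum_univ_three]

lemma inner_centerOne (x : Space3) : inner ℝ centerOne x = x 0 := by
  simp [centerOne, PiLp.inner_apply, Fin.sum_univ_three]

lemma inner_centerTwo (x : Space3) : inner ℝ centerTwo x = -x 0 := by
  simp [centerTwo, PiLp.inner_apply, Fin.sum_univ_three]

/-- Expanding the square, the zero mean kills the cross term. -/
lemma integral_norm_sq_sub_center {x : ℝ → Space3} (hx : Continuous x) {c : Space3}
    (hc : ‖c‖ = 1) (hmean : ∫ t in (0 : ℝ)..(2 * Real.pi), x t = 0) :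
    ∫ t in (0 : ℝ)..(2 * Real.pi), ‖x t - c‖ ^ 2 =
      (∫ t in (0 : ℝ)..(2 * Real.pi), ‖x t‖ ^ 2) + 2 * Real.pi := by
  have h : ∫ t in (0 : ℝ)..(2 * Real.pi), inner ℝ c (x t) = 0 := by
    have := (innerSL ℝ c).intervalIntegral_comp_comm (hx.intervalIntegrable (μ := volume) 0 (2 * Real.pi))
    rw [hmean, map_zero] at this
    simpa using this
  simp only [norm_sq_sub_center _ _ hc]
  rw [intervalIntegral.integral_add, intervalIntegral.integral_sub,
    intervalIntegral.integral_const_mul, h]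
  · simp
  all_goals exact Continuous.intervalIntegrable (by fun_prop) _ _

section action

variable {n : ℕ} {α β m M : ℝ} {q : Fin n → ℝ → Space3}

lemma action_eq (hq : q ∈ loopSpace n) : action α β m M q =
    m / 2 * ∑ i, dirichletEnergy (q i) +
    ((∑ i, ∑ j ∈ Finset.Ioi i, m ^ 2 *
        ∫ t in (0 : ℝ)..(2 * Real.pi), (‖q i t - q j t‖ ^ 2) ^ (-(α / 2))) +
      ∑ i, ((m * M * ∫ t in (0 : ℝ)..(2 * Real.pi), (‖q i t - centerOne‖ ^ 2) ^ (-(β / 2))) +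
        m * M * ∫ t in (0 : ℝ)..(2 * Real.pi), (‖q i t - centerTwo‖ ^ 2) ^ (-(β / 2)))) := by
  obtain ⟨hH, hne, hC⟩ := hq
  have hc : ∀ i, Continuous (q i) := fun i => (hH i).continuous
  have iE : ∀ i, IntervalIntegrable (fun t => ‖deriv (q i) t‖ ^ 2) volume 0 (2 * Real.pi) :=
    fun i => (hH i).intervalIntegrable_deriv_sq
  have key : ∀ (γ c : ℝ) (x : ℝ → Space3), Continuous x → (∀ t, x t ≠ 0) →
      Continuous (fun t => c * (‖x t‖ ^ 2) ^ (-(γ / 2))) := fun γ c x hx h0 =>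
    continuous_const.mul (continuous_rpow_neg (by fun_prop)
      fun t => by have := norm_pos_iff.2 (h0 t); positivity)
  have cP : ∀ i, ∀ j ∈ Finset.Ioi i,
      Continuous (fun t => m ^ 2 * (‖q i t - q j t‖ ^ 2) ^ (-(α / 2))) := fun i j hj =>
    key _ _ _ ((hc i).sub (hc j)) fun t =>
      sub_ne_zero.2 (hne i j (Finset.mem_Ioi.1 hj).ne t)
  have c1 : ∀ i, Continuous (fun t => m * M * (‖q i t - centerOne‖ ^ 2) ^ (-(β / 2))) :=
    fun i => key _ _ _ ((hc i).sub continuous_const) fun t => sub_ne_zero.2 (hC i t).1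
  have c2 : ∀ i, Continuous (fun t => m * M * (‖q i t - centerTwo‖ ^ 2) ^ (-(β / 2))) :=
    fun i => key _ _ _ ((hc i).sub continuous_const) fun t => sub_ne_zero.2 (hC i t).2
  have cPs : ∀ i, Continuous (fun t => ∑ j ∈ Finset.Ioi i,
      m ^ 2 * (‖q i t - q j t‖ ^ 2) ^ (-(α / 2))) := fun i => continuous_finsetSum _ (cP i)
  have c3 : ∀ i, Continuous (fun t => m * M * (‖q i t - centerOne‖ ^ 2) ^ (-(β / 2)) +
      m * M * (‖q i t - centerTwo‖ ^ 2) ^ (-(β / 2))) := fun i => (c1 i).add (c2 i)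
  have cPP := continuous_finsetSum Finset.univ (fun i _ => cPs i)
  have cZ := continuous_finsetSum Finset.univ (fun i _ => c3 i)
  simp only [action, potential, div_norm_rpow]
  rw [intervalIntegral.integral_add, intervalIntegral.integral_const_mul,
    intervalIntegral.integral_finsetSum (fun i _ => iE i),
    intervalIntegral.integral_add (cPP.intervalIntegrable _ _) (cZ.intervalIntegrable _ _),
    intervalIntegral.integral_finsetSum (fun i _ => (cPs i).intervalIntegrable _ _),
    intervalIntegral.integral_finsetSum (fun i _ => (c3 i).intervalIntegrable _ _)]
  · congr 2
    · refine Finset.sum_congr rfl fun i _ => ?_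
      rw [intervalIntegral.integral_finsetSum
        (fun j hj => (cP i j hj).intervalIntegrable _ _)]
      simp only [intervalIntegral.integral_const_mul]
    · refine Finset.sum_congr rfl fun i _ => ?_
      rw [intervalIntegral.integral_add ((c1 i).intervalIntegrable _ _)
        ((c2 i).intervalIntegrable _ _)]
      simp only [intervalIntegral.integral_const_mul]
  · have := (IntervalIntegrable.sum Finset.univ (fun i _ => iE i)).const_mul (m / 2)
    simpa only [Finset.sum_apply] using this
  · exact (cPP.add cZ).intervalIntegrable _ _

end action

/-! ### The action as minimal value plus nonnegative defects -/

section defects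

variable {n : ℕ} [NeZero n] {α β m M R : ℝ} {q : Fin n → ℝ → Space3}

/-- The minimal value of the action. -/
def circularAction (n : ℕ) [NeZero n] (α β m M R : ℝ) : ℝ :=
  2 * Real.pi * (m / 2 * (n * R ^ 2) +
    ((∑ i : Fin n, ∑ j ∈ Finset.Ioi i, m ^ 2 * (chordSq (i - j) * R ^ 2) ^ (-(α / 2))) +
      ∑ _i : Fin n, 2 * (m * M * (1 + R ^ 2) ^ (-(β / 2)))))

/-- The defect of the interaction of the particles `i` and `j`. -/
def pairDefect (α R : ℝ) (q : Fin n → ℝ → Space3) (i j : Fin n) : ℝ :=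
  tangentDefect (α / 2) (chordSq (i - j) * R ^ 2) (chordSq (i - j) * dirichletEnergy (q 0))
    fun t => ‖q i t - q j t‖ ^ 2

/-- The defect of the interaction of a particle with a center. -/
def centerDefect (β R : ℝ) (c : Space3) (x : ℝ → Space3) : ℝ :=
  tangentDefect (β / 2) (1 + R ^ 2) (dirichletEnergy x + 2 * Real.pi) fun t => ‖x t - c‖ ^ 2

lemma dirichletEnergy_eq_of_choreography (hq : q ∈ choreographyLoops n) (i : Fin n) :
    dirichletEnergy (q i) = dirichletEnergy (q 0) := by
  obtain ⟨⟨hH, -, -⟩, -, hch⟩ := hq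
  have e : q i = fun t => q 0 (t + phase i) := funext fun t => hch i t
  have hd : ∀ t, deriv (q i) t = deriv (q 0) (t + phase i) := fun t => by
    rw [e, deriv_comp_add_const]
  have hp : Function.Periodic (fun t => ‖deriv (q 0) t‖ ^ 2) (2 * Real.pi) := fun t => by
    have : deriv (q 0) (t + 2 * Real.pi) = deriv (q 0) t := by
      rw [← deriv_comp_add_const]
      congr 1
      exact funext (hH 0).periodic
    simp only [this]
  rw [dirichletEnergy, dirichletEnergy]
  simp only [hd]
  rw [intervalIntegral.integral_comp_add_right (fun t => ‖deriv (q 0) t‖ ^ 2), zero_add,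
    add_comm (2 * Real.pi), hp.intervalIntegral_add_eq _ 0, zero_add]

/-- An exact identity. Each defect contributes a multiple of `K - 2πR²`, where `K = dirichletEnergy
(q 0)`; by the balance condition these multiples add up to `m / 2 * n`, the coefficient of `K` in
the kinetic term. -/
lemma action_eq_circularAction_add (hbal : IsBalancedRadius n α β m M R)
    (hq : q ∈ choreographyLoops n) : action α β m M q = circularAction n α β m M R +
      ((∑ i, ∑ j ∈ Finset.Ioi i, m ^ 2 * pairDefect α R q i j) +
        ∑ i, (m * M * centerDefect β R centerOne (q i) +
          m * M * centerDefect β R centerTwo (q i))) := by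
  have hK := dirichletEnergy_eq_of_choreography hq
  rw [action_eq hq.1, circularAction]
  simp only [pairDefect, centerDefect, tangentDefect, hK]
  set K := dirichletEnergy (q 0)
  have hpair : ∀ i j : Fin n, m ^ 2 * ((∫ t in (0 : ℝ)..(2 * Real.pi),
        (‖q i t - q j t‖ ^ 2) ^ (-(α / 2))) -
      (2 * Real.pi * (chordSq (i - j) * R ^ 2) ^ (-(α / 2)) -
        α / 2 * (chordSq (i - j) * R ^ 2) ^ (-(α / 2) - 1) *
          (chordSq (i - j) * K - 2 * Real.pi * (chordSq (i - j) * R ^ 2)))) =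
      m ^ 2 * (∫ t in (0 : ℝ)..(2 * Real.pi), (‖q i t - q j t‖ ^ 2) ^ (-(α / 2))) -
      2 * Real.pi * (m ^ 2 * (chordSq (i - j) * R ^ 2) ^ (-(α / 2))) +
      (K - 2 * Real.pi * R ^ 2) *
        (m ^ 2 * (α / 2 * (chordSq (i - j) * R ^ 2) ^ (-(α / 2) - 1)) * chordSq (i - j)) :=
    fun i j => by ring
  simp only [hpair, Finset.sum_add_distrib, Finset.sum_sub_distrib, ← Finset.mul_sum]
  rw [sum_Ioi_sub (fun k => m ^ 2 * (α / 2 * (chordSq k * R ^ 2) ^ (-(α / 2) - 1)) * chordSq k)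
    (fun k => by simp only [chordSq_neg])]
  have hb := hbal
  rw [IsBalancedRadius, ← sub_eq_iff_eq_add] at hb
  rw [← hb]
  simp only [Finset.sum_const, Finset.card_univ, Fintype.card_fin, nsmul_eq_mul]
  ring

/-- Particle `i` is particle `j` advanced by `phase i - phase j`, and `4 sin²` of half this angle is
the squared chord. -/
lemma integral_norm_sq_sub_le_of_choreography {i j : Fin n} (hq : q ∈ choreographyLoops n) :
    ∫ t in (0 : ℝ)..(2 * Real.pi), ‖q i t - q j t‖ ^ 2 ≤
      chordSq (i - j) * dirichletEnergy (q 0) := by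
  have e : ∀ t, q i t = q j (t + (phase i - phase j)) := fun t => by
    rw [hq.2.2 i, hq.2.2 j]
    congr 1
    simp only [phase]; ring
  have h := (hq.1.1 j).integral_shift_le (phase i - phase j)
  rw [dirichletEnergy_eq_of_choreography hq] at h
  have e2 : 4 * Real.sin ((phase i - phase j) / 2) ^ 2 = chordSq (i - j) := by
    have h4 := Real.cos_two_mul ((phase i - phase j) / 2)
    have h5 := Real.sin_sq_add_cos_sq ((phase i - phase j) / 2)
    rw [mul_div_cancel₀ _ two_ne_zero] at h4
    rw [chordSq_sub]
    linarith
  rw [e2] at h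
  simpa only [e] using h

lemma pairDefect_nonneg (hα : 0 < α) (hR : 0 < R) (hq : q ∈ choreographyLoops n) {i j : Fin n}
    (hij : i ≠ j) : 0 ≤ pairDefect α R q i j := by
  have hi := (hq.1.1 i).continuous
  have hj := (hq.1.1 j).continuous
  refine tangentDefect_nonneg (by positivity)
    (mul_pos (chordSq_pos (sub_ne_zero.2 hij)) (by positivity)) (by fun_prop) (fun t => ?_)
    (integral_norm_sq_sub_le_of_choreography hq)
  have := norm_pos_iff.2 (sub_ne_zero.2 (hq.1.2.1 i j hij t))
  positivity

variable {x : ℝ → Space3} {c : Space3}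

lemma IsPeriodicH1.integral_norm_sq_sub_center_le (hx : IsPeriodicH1 x)
    (hmean : ∫ t in (0 : ℝ)..(2 * Real.pi), x t = 0) (hc : ‖c‖ = 1) :
    ∫ t in (0 : ℝ)..(2 * Real.pi), ‖x t - c‖ ^ 2 ≤ dirichletEnergy x + 2 * Real.pi := by
  rw [integral_norm_sq_sub_center hx.continuous hc hmean]
  linarith [hx.wirtinger hmean]

lemma IsPeriodicH1.centerDefect_nonneg (hβ : 0 < β) (hx : IsPeriodicH1 x)
    (hmean : ∫ t in (0 : ℝ)..(2 * Real.pi), x t = 0) (hc : ‖c‖ = 1) (hne : ∀ t, x t ≠ c) :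
    0 ≤ centerDefect β R c x := by
  have := hx.continuous
  refine tangentDefect_nonneg (by positivity) (by positivity) (by fun_prop) (fun t => ?_)
    (hx.integral_norm_sq_sub_center_le hmean hc)
  have := norm_pos_iff.2 (sub_ne_zero.2 (hne t))
  positivity

lemma IsPeriodicH1.norm_sub_center_of_centerDefect_eq_zero (hβ : 0 < β) (hx : IsPeriodicH1 x)
    (hmean : ∫ t in (0 : ℝ)..(2 * Real.pi), x t = 0) (hc : ‖c‖ = 1) (hne : ∀ t, x t ≠ c)
    (h0 : centerDefect β R c x = 0) :
    (∀ t ∈ Set.Icc 0 (2 * Real.pi), ‖x t - c‖ ^ 2 = 1 + R ^ 2) ∧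
      ∫ t in (0 : ℝ)..(2 * Real.pi), ‖x t‖ ^ 2 = dirichletEnergy x := by
  have hcont := hx.continuous
  have h := tangentDefect_eq_zero (by positivity) (by positivity) (by fun_prop) (fun t => ?_)
    (hx.integral_norm_sq_sub_center_le hmean hc) h0
  · refine ⟨h.1, ?_⟩
    have h2 := h.2
    rw [integral_norm_sq_sub_center hcont hc hmean] at h2
    linarith
  · have := norm_pos_iff.2 (sub_ne_zero.2 (hne t))
    positivity

/-- All other defects are discarded: the two center defects of particle `0` already suffice for
rigidity, since a choreography is determined by that particle. -/
lemma circularAction_add_centerDefect_le (hα : 0 < α) (hβ : 0 < β) (hm : 0 < m) (hM : 0 < M)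
    (hR : 0 < R) (hbal : IsBalancedRadius n α β m M R) (hq : q ∈ choreographyLoops n) :
    circularAction n α β m M R + (m * M * centerDefect β R centerOne (q 0) +
      m * M * centerDefect β R centerTwo (q 0)) ≤ action α β m M q := by
  rw [action_eq_circularAction_add hbal hq]
  have h1 : 0 ≤ ∑ i, ∑ j ∈ Finset.Ioi i, m ^ 2 * pairDefect α R q i j :=
    Finset.sum_nonneg fun i _ => Finset.sum_nonneg fun j hj =>
      mul_nonneg (by positivity) (pairDefect_nonneg hα hR hq (Finset.mem_Ioi.1 hj).ne)
  have h2 := Finset.single_le_sum (f := fun i => m * M * centerDefect β R centerOne (q i) +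
      m * M * centerDefect β R centerTwo (q i)) (fun i _ => add_nonneg
        (mul_nonneg (by positivity) ((hq.1.1 i).centerDefect_nonneg hβ (hq.2.1 i) norm_centerOne
          fun t => (hq.1.2.2 i t).1))
        (mul_nonneg (by positivity) ((hq.1.1 i).centerDefect_nonneg hβ (hq.2.1 i) norm_centerTwo
          fun t => (hq.1.2.2 i t).2))) (Finset.mem_univ 0)
  linarith

end defects

/-! ### Calculus on circles -/

/-- The position at angle `θ` on the circle of radius `R` with axes `u`, `v`. -/
def circlePoint (R : ℝ) (u v : Space3) (θ : ℝ) : Space3 := R • (Real.cos θ • u + Real.sin θ • v)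

section circlePoint

variable {R : ℝ} {u v : Space3}

lemma norm_sq_smul_add_smul (hu : ‖u‖ = 1) (hv : ‖v‖ = 1) (huv : inner ℝ u v = 0) (a b : ℝ) :
    ‖a • u + b • v‖ ^ 2 = a ^ 2 + b ^ 2 := by
  rw [norm_add_sq_real, norm_smul, norm_smul, inner_smul_left, inner_smul_right, huv, hu, hv]
  simp

lemma norm_circlePoint_sq (hu : ‖u‖ = 1) (hv : ‖v‖ = 1) (huv : inner ℝ u v = 0) (θ : ℝ) :
    ‖circlePoint R u v θ‖ ^ 2 = R ^ 2 := by
  rw [circlePoint, norm_smul, mul_pow, norm_sq_smul_add_smul hu hv huv]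
  simp

lemma norm_circlePoint_sub_sq (hu : ‖u‖ = 1) (hv : ‖v‖ = 1) (huv : inner ℝ u v = 0) (θ φ : ℝ) :
    ‖circlePoint R u v θ - circlePoint R u v φ‖ ^ 2 = (2 - 2 * Real.cos (θ - φ)) * R ^ 2 := by
  have e : circlePoint R u v θ - circlePoint R u v φ =
      R • ((Real.cos θ - Real.cos φ) • u + (Real.sin θ - Real.sin φ) • v) := by
    simp only [circlePoint]; module
  rw [e, norm_smul, mul_pow, norm_sq_smul_add_smul hu hv huv, Real.norm_eq_abs, sq_abs,
    Real.cos_sub]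
  nlinarith [Real.sin_sq_add_cos_sq θ, Real.sin_sq_add_cos_sq φ]

/-- Differentiation rotates the frame `(u, v)` to `(v, -u)`, so velocities and accelerations are
again of the form `circlePoint`. -/
lemma hasDerivAt_circlePoint (c t : ℝ) :
    HasDerivAt (fun t => circlePoint R u v (t + c)) (circlePoint R v (-u) (t + c)) t := by
  have h1 : HasDerivAt (fun t => Real.cos (t + c)) (-Real.sin (t + c)) t := by
    simpa using ((hasDerivAt_id t).add_const c).cos
  have h2 : HasDerivAt (fun t => Real.sin (t + c)) (Real.cos (t + c)) t := by
    simpa using ((hasDerivAt_id t).add_const c).sin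
  convert! ((h1.smul_const u).add (h2.smul_const v)).const_smul R using 1
  simp only [circlePoint]; module

lemma deriv_circlePoint (c : ℝ) : deriv (fun t => circlePoint R u v (t + c)) =
    fun t => circlePoint R v (-u) (t + c) :=
  funext fun t => (hasDerivAt_circlePoint c t).deriv

lemma contDiff_circlePoint (c : ℝ) (k : WithTop ℕ∞) :
    ContDiff ℝ k (fun t => circlePoint R u v (t + c)) := by
  unfold circlePoint
  have h1 : ContDiff ℝ k (fun t => Real.cos (t + c)) := Real.contDiff_cos.comp (by fun_prop)
  have h2 : ContDiff ℝ k (fun t => Real.sin (t + c)) := Real.contDiff_sin.comp (by fun_prop)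
  fun_prop

lemma circlePoint_apply_zero (hu : u 0 = 0) (hv : v 0 = 0) (θ : ℝ) :
    circlePoint R u v θ 0 = 0 := by
  simp [circlePoint, hu, hv]

lemma circlePoint_add_two_pi (θ : ℝ) :
    circlePoint R u v (θ + 2 * Real.pi) = circlePoint R u v θ := by
  simp [circlePoint]

lemma circlePoint_add_pi (θ : ℝ) :
    circlePoint R u v (θ + Real.pi) = -circlePoint R u v θ := by
  simp only [circlePoint, Real.cos_add_pi, Real.sin_add_pi]; module

lemma isPeriodicH1_circlePoint (hu : ‖u‖ = 1) (hv : ‖v‖ = 1) (huv : inner ℝ u v = 0) (c : ℝ) :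
    IsPeriodicH1 (fun t => circlePoint R u v (t + c)) where
  periodic t := by
    simp only [add_right_comm t (2 * Real.pi) c, circlePoint_add_two_pi]
  absolutelyContinuous := (contDiff_circlePoint c 1).contDiffOn.absolutelyContinuousOnInterval
  memLp_deriv := by
    rw [deriv_circlePoint]
    refine MemLp.of_bound (contDiff_circlePoint c 0).continuous.aestronglyMeasurable |R| ?_
    refine Filter.Eventually.of_forall fun t => ?_
    rw [← sq_le_sq₀ (norm_nonneg _) (abs_nonneg _), norm_circlePoint_sq hv (by rwa [norm_neg])
      (by rw [inner_neg_right, real_inner_comm, huv, neg_zero]), sq_abs]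

lemma integral_circlePoint (c : ℝ) :
    ∫ t in (0 : ℝ)..(2 * Real.pi), circlePoint R u v (t + c) = 0 := by
  have h := intervalIntegral.integral_eq_sub_of_hasDerivAt (a := 0) (b := 2 * Real.pi)
    (fun t _ => hasDerivAt_circlePoint (R := R) (u := -v) (v := u) c t)
    ((contDiff_circlePoint c 0).continuous.intervalIntegrable _ _)
  rw [neg_neg, add_comm (2 * Real.pi) c, circlePoint_add_two_pi, zero_add, sub_self] at h
  exact h

end circlePoint

/-! ### Uniform circular motions and the equality case -/

section uniform

variable {n : ℕ} {R : ℝ} {q : Fin n → ℝ → Space3}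

lemma isUniformCircularMotion_iff : IsUniformCircularMotion R q ↔
    ∃ u v : Space3, u 0 = 0 ∧ v 0 = 0 ∧ ‖u‖ = 1 ∧ ‖v‖ = 1 ∧ inner ℝ u v = 0 ∧
      q = fun i t => circlePoint R u v (t + phase i) := by
  simp only [IsUniformCircularMotion, funext_iff, circlePoint, phase]

lemma IsUniformCircularMotion.norm_sub_centerOne_sq (hq : IsUniformCircularMotion R q) (i : Fin n)
    (t : ℝ) : ‖q i t - centerOne‖ ^ 2 = 1 + R ^ 2 := by
  obtain ⟨u, v, hu0, hv0, hu, hv, huv, rfl⟩ := isUniformCircularMotion_iff.1 hq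
  rw [norm_sq_sub_center _ _ norm_centerOne, inner_centerOne, norm_circlePoint_sq hu hv huv,
    circlePoint_apply_zero hu0 hv0]
  ring

lemma IsUniformCircularMotion.norm_sub_centerTwo_sq (hq : IsUniformCircularMotion R q) (i : Fin n)
    (t : ℝ) : ‖q i t - centerTwo‖ ^ 2 = 1 + R ^ 2 := by
  obtain ⟨u, v, hu0, hv0, hu, hv, huv, rfl⟩ := isUniformCircularMotion_iff.1 hq
  rw [norm_sq_sub_center _ _ norm_centerTwo, inner_centerTwo, norm_circlePoint_sq hu hv huv,
    circlePoint_apply_zero hu0 hv0]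
  ring

lemma IsUniformCircularMotion.dirichletEnergy (hq : IsUniformCircularMotion R q) (i : Fin n) :
    dirichletEnergy (q i) = 2 * Real.pi * R ^ 2 := by
  obtain ⟨u, v, -, -, hu, hv, huv, rfl⟩ := isUniformCircularMotion_iff.1 hq
  rw [_root_.dirichletEnergy, deriv_circlePoint]
  simp [norm_circlePoint_sq hv (u := v) (v := -u) (by rwa [norm_neg])
      (by rw [inner_neg_right, real_inner_comm, huv, neg_zero])]

variable [NeZero n]

lemma IsUniformCircularMotion.norm_sub_sq (hq : IsUniformCircularMotion R q) (i j : Fin n)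
    (t : ℝ) : ‖q i t - q j t‖ ^ 2 = chordSq (i - j) * R ^ 2 := by
  obtain ⟨u, v, -, -, hu, hv, huv, rfl⟩ := isUniformCircularMotion_iff.1 hq
  rw [norm_circlePoint_sub_sq hu hv huv, chordSq_sub, add_sub_add_left_eq_sub]

lemma IsUniformCircularMotion.mem_loopSpace (hR : 0 < R) (hq : IsUniformCircularMotion R q) :
    q ∈ loopSpace n := by
  refine ⟨?_, fun i j hij t h => ?_, fun k t => ⟨fun h => ?_, fun h => ?_⟩⟩
  · obtain ⟨u, v, -, -, hu, hv, huv, rfl⟩ := isUniformCircularMotion_iff.1 hq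
    exact fun i => isPeriodicH1_circlePoint hu hv huv _
  · have h1 := hq.norm_sub_sq i j t
    rw [h, sub_self, norm_zero, zero_pow two_ne_zero] at h1
    exact (mul_pos (chordSq_pos (sub_ne_zero.2 hij)) (pow_pos hR 2)).ne h1
  · have h1 := hq.norm_sub_centerOne_sq k t
    rw [h, sub_self, norm_zero] at h1
    nlinarith
  · have h1 := hq.norm_sub_centerTwo_sq k t
    rw [h, sub_self, norm_zero] at h1
    nlinarith

lemma IsUniformCircularMotion.mem_choreographyLoops (hR : 0 < R)
    (hq : IsUniformCircularMotion R q) : q ∈ choreographyLoops n := by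
  refine ⟨hq.mem_loopSpace hR, ?_⟩
  obtain ⟨u, v, -, -, hu, hv, huv, rfl⟩ := isUniformCircularMotion_iff.1 hq
  refine ⟨fun i => integral_circlePoint _, fun i t => ?_⟩
  simp only [phase_zero, add_zero]
  rfl

variable {α β m M : ℝ}

/-- Every squared distance is constantly its tangency value `y₀`, and `K = 2πR²` turns every bound
`B` into `2π y₀`; all defects vanish. -/
lemma IsUniformCircularMotion.action_eq (hR : 0 < R) (hbal : IsBalancedRadius n α β m M R)
    (hq : IsUniformCircularMotion R q) :
    action α β m M q = circularAction n α β m M R := by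
  rw [action_eq_circularAction_add hbal (hq.mem_choreographyLoops hR)]
  have h1 : ∀ i j, pairDefect α R q i j = 0 := fun i j => by
    rw [pairDefect, hq.dirichletEnergy, mul_left_comm]
    exact tangentDefect_of_const (hq.norm_sub_sq i j)
  have e : 2 * Real.pi * R ^ 2 + 2 * Real.pi = 2 * Real.pi * (1 + R ^ 2) := by ring
  have h2 : ∀ i, centerDefect β R centerOne (q i) = 0 := fun i => by
    rw [centerDefect, hq.dirichletEnergy, e]
    exact tangentDefect_of_const (hq.norm_sub_centerOne_sq i)
  have h3 : ∀ i, centerDefect β R centerTwo (q i) = 0 := fun i => by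
    rw [centerDefect, hq.dirichletEnergy, e]
    exact tangentDefect_of_const (hq.norm_sub_centerTwo_sq i)
  simp [h1, h2, h3]

lemma circularAction_le (hα : 0 < α) (hβ : 0 < β) (hm : 0 < m) (hM : 0 < M)
    (hR : 0 < R) (hbal : IsBalancedRadius n α β m M R) (hq : q ∈ choreographyLoops n) :
    circularAction n α β m M R ≤ action α β m M q := by
  have h := circularAction_add_centerDefect_le hα hβ hm hM hR hbal hq
  have h1 := (hq.1.1 0).centerDefect_nonneg (R := R) hβ (hq.2.1 0) norm_centerOne
    fun t => (hq.1.2.2 0 t).1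
  have h2 := (hq.1.1 0).centerDefect_nonneg (R := R) hβ (hq.2.1 0) norm_centerTwo
    fun t => (hq.1.2.2 0 t).2
  have h3 : 0 < m * M := mul_pos hm hM
  nlinarith [mul_nonneg h3.le h1, mul_nonneg h3.le h2]

lemma isUniformCircularMotion_of_action_le (hα : 0 < α) (hβ : 0 < β) (hm : 0 < m) (hM : 0 < M)
    (hR : 0 < R) (hbal : IsBalancedRadius n α β m M R) (hq : q ∈ choreographyLoops n)
    (hle : action α β m M q ≤ circularAction n α β m M R) : IsUniformCircularMotion R q := by
  have h := circularAction_add_centerDefect_le hα hβ hm hM hR hbal hq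
  have hx := hq.1.1 0
  have n1 := fun t => (hq.1.2.2 0 t).1
  have n2 := fun t => (hq.1.2.2 0 t).2
  have h1 := hx.centerDefect_nonneg (R := R) hβ (hq.2.1 0) norm_centerOne n1
  have h2 := hx.centerDefect_nonneg (R := R) hβ (hq.2.1 0) norm_centerTwo n2
  have h3 : 0 < m * M := mul_pos hm hM
  have z1 : centerDefect β R centerOne (q 0) = 0 := by
    by_contra hne
    have := mul_pos h3 (lt_of_le_of_ne h1 (Ne.symm hne))
    linarith [mul_nonneg h3.le h2]
  have z2 : centerDefect β R centerTwo (q 0) = 0 := by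
    by_contra hne
    have := mul_pos h3 (lt_of_le_of_ne h2 (Ne.symm hne))
    linarith [mul_nonneg h3.le h1]
  obtain ⟨d1, hW⟩ := hx.norm_sub_center_of_centerDefect_eq_zero hβ (hq.2.1 0) norm_centerOne n1 z1
  obtain ⟨d2, -⟩ := hx.norm_sub_center_of_centerDefect_eq_zero hβ (hq.2.1 0) norm_centerTwo n2 z2
  -- Subtracting the two sphere equations gives the plane `x = 0`; adding them gives the norm.
  have hgeo : ∀ t ∈ Set.Icc 0 (2 * Real.pi), q 0 t 0 = 0 ∧ ‖q 0 t‖ ^ 2 = R ^ 2 := fun t ht => by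
    have e1 := d1 t ht
    have e2 := d2 t ht
    rw [norm_sq_sub_center _ _ norm_centerOne, inner_centerOne] at e1
    rw [norm_sq_sub_center _ _ norm_centerTwo, inner_centerTwo] at e2
    constructor <;> linarith
  obtain ⟨a, b, hab⟩ := hx.eq_cos_sin_of_wirtinger_eq (hq.2.1 0) hW
  have hpi := Real.pi_pos
  -- Times `0` and `π / 2` put `a` and `b` in the plane with norm `R`; time `π / 4` then gives their
  -- orthogonality.
  have ha := hgeo 0 ⟨le_rfl, by positivity⟩
  have hb := hgeo (Real.pi / 2) ⟨by positivity, by linarith⟩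
  have hc := hgeo (Real.pi / 4) ⟨by positivity, by linarith⟩
  rw [hab] at ha hb hc
  simp only [Real.cos_zero, Real.sin_zero, Real.cos_pi_div_two, Real.sin_pi_div_two, one_smul,
    zero_smul, add_zero, zero_add] at ha hb
  rw [Real.cos_pi_div_four, Real.sin_pi_div_four, ← smul_add, norm_smul, mul_pow,
    norm_add_sq_real, ha.2, hb.2, Real.norm_eq_abs, sq_abs, div_pow,
    Real.sq_sqrt zero_le_two] at hc
  have hin : inner ℝ a b = 0 := by linarith [hc.2]
  have na : ‖a‖ = R := (sq_eq_sq₀ (norm_nonneg _) hR.le).1 ha.2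
  have nb : ‖b‖ = R := (sq_eq_sq₀ (norm_nonneg _) hR.le).1 hb.2
  refine isUniformCircularMotion_iff.2 ⟨R⁻¹ • a, R⁻¹ • b, by simp [ha.1], by simp [hb.1], ?_, ?_,
    ?_, ?_⟩
  · rw [norm_smul, na, Real.norm_of_nonneg (by positivity), inv_mul_cancel₀ hR.ne']
  · rw [norm_smul, nb, Real.norm_of_nonneg (by positivity), inv_mul_cancel₀ hR.ne']
  · rw [inner_smul_left, inner_smul_right, hin]; simp
  · funext i t
    rw [hq.2.2 i t, hab, circlePoint, smul_comm _ R⁻¹, smul_comm _ R⁻¹, ← smul_add,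
      smul_inv_smul₀ hR.ne']
    rfl

end uniform

/-! ### The group action on loops -/

/-- `timeAct` returns the representative of `t + a` in `(-π, π]`, which a periodic function does not
distinguish from `t + a`. -/
lemma timeAct_rotation {E : Type*} {f : ℝ → E} (hf : Function.Periodic f (2 * Real.pi)) (a t : ℝ) :
    f (timeAct (rotation (Circle.exp a)) t) = f (t + a) := by
  have e : timeAct (rotation (Circle.exp a)) t = toIocMod Real.two_pi_pos (-Real.pi) (t + a) := by
    rw [timeAct, rotation_apply, Circle.coe_exp, ← Complex.exp_add, ← Complex.arg_exp_mul_I]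
    congr 2
    push_cast; ring
  rw [e, toIocMod]
  exact hf.sub_zsmul_eq _

lemma timeAct_one {E : Type*} {f : ℝ → E} (hf : Function.Periodic f (2 * Real.pi)) (t : ℝ) :
    f (timeAct 1 t) = f t := by
  have := timeAct_rotation hf 0 t
  rwa [Circle.exp_zero, map_one, add_zero] at this

lemma timeAct_mul (S T : ℂ ≃ₗᵢ[ℝ] ℂ) (t : ℝ) :
    timeAct (S * T) t = timeAct S (timeAct T t) := by
  have h : ‖T (Complex.exp (t * Complex.I))‖ = 1 := by
    rw [LinearIsometryEquiv.norm_map, Complex.norm_exp_ofReal_mul_I]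
  have h2 := Complex.norm_mul_exp_arg_mul_I (T (Complex.exp (t * Complex.I)))
  rw [h, Complex.ofReal_one, one_mul] at h2
  simp only [timeAct]
  rw [h2]
  rfl

section loopAct

variable {n : ℕ} {G : Type*} [Group G] (ρ : G →* (Space3 ≃ₗᵢ[ℝ] Space3))
    (τ : G →* (ℂ ≃ₗᵢ[ℝ] ℂ)) (σ : G →* Equiv.Perm (Fin n))

lemma loopAct_mul (g h : G) (q : Fin n → ℝ → Space3) :
    loopAct ρ τ σ (g * h) q = loopAct ρ τ σ g (loopAct ρ τ σ h q) := by
  funext i t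
  simp only [loopAct, map_mul, mul_inv_rev, timeAct_mul]
  rfl

lemma loopAct_one {q : Fin n → ℝ → Space3} (hq : ∀ i, Function.Periodic (q i) (2 * Real.pi)) :
    loopAct ρ τ σ 1 q = q := by
  funext i t
  simp only [loopAct, map_one, inv_one]
  exact timeAct_one (hq i) t

/-- Invariance passes from generators to the group. Periodicity is needed because even the identity
normalizes times to `(-π, π]`. -/
lemma loopAct_eq_of_closure {q : Fin n → ℝ → Space3}
    (hq : ∀ i, Function.Periodic (q i) (2 * Real.pi)) {S : Set G}
    (hS : Subgroup.closure S = ⊤) (h : ∀ g ∈ S, loopAct ρ τ σ g q = q) (g : G) :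
    loopAct ρ τ σ g q = q := by
  have hg : g ∈ Subgroup.closure S := by rw [hS]; trivial
  induction hg using Subgroup.closure_induction with
  | mem x hx => exact h x hx
  | one => exact loopAct_one ρ τ σ hq
  | mul x y _ _ hx hy => rw [loopAct_mul, hy, hx]
  | inv x _ hx =>
    conv_lhs => rw [← hx]
    rw [← loopAct_mul, inv_mul_cancel, loopAct_one ρ τ σ hq]

variable [NeZero n] {ρ τ σ} {g₁ g₂ : G}

lemma mem_fixedLoops_iff (hgen : Subgroup.closure {g₁, g₂} = (⊤ : Subgroup G))
    (hρ₁ : ρ g₁ = 1) (hσ₁ : ∀ i : Fin n, σ g₁⁻¹ i = i - 1)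
    (hτ₁ : τ g₁⁻¹ = rotation (Circle.exp (2 * Real.pi / n)))
    (hρ₂ : ρ g₂ = LinearIsometryEquiv.neg ℝ) (hσ₂ : ∀ i : Fin n, σ g₂⁻¹ i = i)
    (hτ₂ : τ g₂⁻¹ = rotation (Circle.exp Real.pi)) {q : Fin n → ℝ → Space3} :
    q ∈ fixedLoops ρ τ σ ↔ q ∈ loopSpace n ∧
      (∀ i t, q (i - 1) (t + 2 * Real.pi / n) = q i t) ∧ ∀ i t, -q i (t + Real.pi) = q i t := by
  refine and_congr_right fun hq => ?_
  have hp : ∀ i, Function.Periodic (q i) (2 * Real.pi) := fun i => (hq.1 i).periodic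
  have e₁ : ∀ i t, loopAct ρ τ σ g₁ q i t = q (i - 1) (t + 2 * Real.pi / n) := fun i t => by
    rw [loopAct, hρ₁, hσ₁, hτ₁, timeAct_rotation (hp _)]
    rfl
  have e₂ : ∀ i t, loopAct ρ τ σ g₂ q i t = -q i (t + Real.pi) := fun i t => by
    rw [loopAct, hρ₂, hσ₂, hτ₂, timeAct_rotation (hp _)]
    rfl
  constructor
  · intro h
    exact ⟨fun i t => by rw [← e₁, h], fun i t => by rw [← e₂, h]⟩
  · rintro ⟨h₁, h₂⟩
    refine loopAct_eq_of_closure ρ τ σ hp hgen ?_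
    rintro g (rfl | rfl)
    · funext i t; rw [e₁, h₁]
    · funext i t; rw [e₂, h₂]

end loopAct

/-! ### From symmetry to zero mean choreographies -/

section choreography

variable {n : ℕ} {q : Fin n → ℝ → Space3}

lemma IsUniformCircularMotion.antiperiodic {R : ℝ} (hq : IsUniformCircularMotion R q)
    (i : Fin n) (t : ℝ) : -q i (t + Real.pi) = q i t := by
  obtain ⟨u, v, -, -, -, -, -, rfl⟩ := isUniformCircularMotion_iff.1 hq
  simp only [add_right_comm t Real.pi, circlePoint_add_pi, neg_neg]

variable [NeZero n]

lemma eq_shift_of_cyclic (h : ∀ i t, q (i - 1) (t + 2 * Real.pi / n) = q i t) (i : Fin n) (t : ℝ) :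
    q i t = q 0 (t + (i : ℕ) * (2 * Real.pi / n)) := by
  obtain ⟨k, hk⟩ := i
  induction k generalizing t with
  | zero => simp
  | succ k ih =>
    have e : (⟨k + 1, hk⟩ : Fin n) - 1 = ⟨k, by omega⟩ := by
      rw [sub_eq_iff_eq_add]
      apply Fin.ext
      rw [Fin.val_add, Fin.val_one', Nat.mod_eq_of_lt (a := 1) (by omega)]
      exact (Nat.mod_eq_of_lt hk).symm
    rw [← h, e, ih]
    congr 1
    push_cast; ring

/-- Shifting by `π` preserves the integral over a period and also changes its sign. -/
lemma integral_eq_zero_of_antiperiodic {x : ℝ → Space3} (hx : IsPeriodicH1 x)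
    (h : ∀ t, -x (t + Real.pi) = x t) : ∫ t in (0 : ℝ)..(2 * Real.pi), x t = 0 := by
  have h1 : ∫ t in (0 : ℝ)..(2 * Real.pi), x (t + Real.pi) =
      ∫ t in (0 : ℝ)..(2 * Real.pi), x t := by
    rw [intervalIntegral.integral_comp_add_right x, zero_add, add_comm (2 * Real.pi),
      hx.periodic.intervalIntegral_add_eq _ 0, zero_add]
  have h2 : ∫ t in (0 : ℝ)..(2 * Real.pi), x t = -∫ t in (0 : ℝ)..(2 * Real.pi), x t := by
    conv_rhs => rw [← h1, ← intervalIntegral.integral_neg]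
    simp only [h]
  have h3 := add_eq_zero_iff_eq_neg.2 h2
  rw [← two_smul ℝ] at h3
  exact (smul_eq_zero.1 h3).resolve_left two_ne_zero

lemma mem_choreographyLoops_of_symmetric (hq : q ∈ loopSpace n)
    (h₁ : ∀ i t, q (i - 1) (t + 2 * Real.pi / n) = q i t)
    (h₂ : ∀ i t, -q i (t + Real.pi) = q i t) : q ∈ choreographyLoops n :=
  ⟨hq, fun i => integral_eq_zero_of_antiperiodic (hq.1 i) (h₂ i), eq_shift_of_cyclic h₁⟩

lemma IsUniformCircularMotion.cyclic {R : ℝ} (hn : 2 ≤ n) (hq : IsUniformCircularMotion R q)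
    (i : Fin n) (t : ℝ) : q (i - 1) (t + 2 * Real.pi / n) = q i t := by
  obtain ⟨u, v, -, -, -, -, -, rfl⟩ := isUniformCircularMotion_iff.1 hq
  obtain ⟨z, hz⟩ := phase_sub i 1
  have h1 : phase (1 : Fin n) = 2 * Real.pi / n := by
    -- Here `n ≥ 2` matters: in `Fin 1` the element `1` has value `0`.
    rw [phase, Fin.val_one', Nat.mod_eq_of_lt (by omega)]
    simp
  have e : t + 2 * Real.pi / n + phase (i - 1) = t + phase i + z * (2 * Real.pi) := by
    rw [hz, h1]; ring
  have hp : Function.Periodic (circlePoint R u v) (2 * Real.pi) := circlePoint_add_two_pi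
  simp only [e]
  exact hp.int_mul z _

end choreography

/-! ### Gradient of the potential and the equations of motion -/

/-- The force at `x` of a center at `p` with potential `c / |x - p| ^ γ`. -/
def powerForce (c γ : ℝ) (p x : Space3) : Space3 :=
  -(c * (γ * (‖x - p‖ ^ 2) ^ (-(γ / 2) - 1))) • (x - p)

lemma hasFDerivAt_power (c γ : ℝ) {p x : Space3} (hx : x ≠ p) :
    HasFDerivAt (fun y : Space3 => c * (‖y - p‖ ^ 2) ^ (-(γ / 2)))
      (innerSL ℝ (powerForce c γ p x)) x := by
  have h0 : ‖x - p‖ ^ 2 ≠ 0 := by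
    have := norm_pos_iff.2 (sub_ne_zero.2 hx)
    positivity
  have h1 : HasFDerivAt (fun y : Space3 => ‖y - p‖ ^ 2) (2 • innerSL ℝ (x - p)) x :=
    ((hasFDerivAt_id x).sub_const p).norm_sq
  have h2 := (h1.rpow_const (p := -(γ / 2)) (Or.inl h0)).const_mul c
  convert! h2 using 1
  ext y
  simp only [powerForce, innerSL_apply_apply, inner_smul_left, smul_apply,
    smul_eq_mul, nsmul_eq_mul, conj_trivial]
  push_cast
  ring

lemma hasFDerivAt_power' (c γ : ℝ) {p x : Space3} (hx : x ≠ p) :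
    HasFDerivAt (fun y : Space3 => c * (‖p - y‖ ^ 2) ^ (-(γ / 2)))
      (innerSL ℝ (powerForce c γ p x)) x := by
  simpa only [norm_sub_rev p] using hasFDerivAt_power c γ hx

section gradient

variable {n : ℕ} {α β m M : ℝ}

/-- Differentiating a sum over pairs `a < b` in the position of particle `i` yields one indicator
for each slot that `i` can occupy; together they give one term for every other particle. -/
lemma sum_offDiag_ite (i : Fin n) (g : Fin n → Space3) :
    ∑ a, ∑ b ∈ Finset.Ioi a, ((if b = i then g a else 0) + (if a = i then g b else 0)) =
      ∑ b ∈ ({i}ᶜ : Finset (Fin n)), g b := by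
  rw [Finset.sum_sum_Ioi_add_eq_sum_sum_off_diag (fun a b : Fin n => if a = i then g b else 0)]
  simp only [Finset.sum_ite_eq', Finset.mem_compl, Finset.mem_singleton]
  rw [← Finset.sum_filter]
  refine Finset.sum_congr ?_ fun _ _ => rfl
  ext a
  simp [eq_comm]

/-- The gradient of the potential with respect to the position of one particle. -/
lemma hasGradientAt_potential {q : Fin n → Space3} (hne : ∀ i j, i ≠ j → q i ≠ q j)
    (hC : ∀ k, q k ≠ centerOne ∧ q k ≠ centerTwo) (i : Fin n) :
    HasGradientAt (fun x : Space3 => potential α β m M (Function.update q i x))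
      ((∑ b ∈ ({i}ᶜ : Finset (Fin n)), powerForce (m ^ 2) α (q b) (q i)) +
        (powerForce (m * M) β centerOne (q i) + powerForce (m * M) β centerTwo (q i))) (q i) := by
  rw [hasGradientAt_iff_hasFDerivAt]
  change HasFDerivAt _ (innerSL ℝ _) _
  simp only [potential, div_norm_rpow]
  have hpair : ∀ a, ∀ b ∈ Finset.Ioi a, HasFDerivAt (fun x : Space3 =>
      m ^ 2 * (‖Function.update q i x a - Function.update q i x b‖ ^ 2) ^ (-(α / 2)))
      (innerSL ℝ ((if b = i then powerForce (m ^ 2) α (q a) (q i) else 0) +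
        (if a = i then powerForce (m ^ 2) α (q b) (q i) else 0))) (q i) := by
    intro a b hab
    have hab' : a ≠ b := (Finset.mem_Ioi.1 hab).ne
    by_cases ha : a = i
    · subst ha
      simp only [Function.update_self, Function.update_of_ne hab'.symm, if_neg hab'.symm, if_true,
        zero_add]
      exact hasFDerivAt_power _ _ (hne _ _ hab')
    · by_cases hb : b = i
      · subst hb
        simp only [Function.update_self, Function.update_of_ne ha, if_neg ha, if_true, add_zero]
        exact hasFDerivAt_power' _ _ (hne _ _ hab'.symm)
      · simp only [Function.update_of_ne ha, Function.update_of_ne hb, if_neg ha, if_neg hb,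
          add_zero, map_zero]
        exact hasFDerivAt_const _ _
  have hcenter : ∀ c : Space3, (∀ k, q k ≠ c) → ∀ a, HasFDerivAt (fun x : Space3 =>
      m * M * (‖Function.update q i x a - c‖ ^ 2) ^ (-(β / 2)))
      (innerSL ℝ (if a = i then powerForce (m * M) β c (q i) else 0)) (q i) := by
    intro c hc a
    by_cases ha : a = i
    · subst ha
      simp only [Function.update_self, if_true]
      exact hasFDerivAt_power _ _ (hc _)
    · simp only [Function.update_of_ne ha, if_neg ha, map_zero]
      exact hasFDerivAt_const _ _
  have h1 := HasFDerivAt.fun_sum (u := Finset.univ) fun a _ =>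
    HasFDerivAt.fun_sum (hpair a)
  have h2 := HasFDerivAt.fun_sum (u := Finset.univ) fun a _ =>
    (hcenter centerOne (fun k => (hC k).1) a).fun_add (hcenter centerTwo (fun k => (hC k).2) a)
  have h3 := h1.fun_add h2
  simp only [← map_sum, ← map_add, sum_offDiag_ite] at h3
  simp only [Finset.sum_add_distrib, Finset.sum_ite_eq',
    Finset.mem_univ, if_true] at h3
  simpa only [Finset.sum_add_distrib] using h3

end gradient

section equation

/-- Splits a chord into its radial and tangential parts at `θ`, so that the forces can be summed
separately in the two directions. -/
lemma circlePoint_sub {R : ℝ} {u v : Space3} (θ φ : ℝ) :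
    circlePoint R u v θ - circlePoint R u v φ =
      ((2 - 2 * Real.cos (θ - φ)) / 2) • circlePoint R u v θ +
        Real.sin (θ - φ) • circlePoint R v (-u) θ := by
  have h := sub_sub_cancel θ φ
  have hc : Real.cos φ = Real.cos θ * Real.cos (θ - φ) + Real.sin θ * Real.sin (θ - φ) := by
    rw [← Real.cos_sub, h]
  have hs : Real.sin φ = Real.sin θ * Real.cos (θ - φ) - Real.cos θ * Real.sin (θ - φ) := by
    rw [← Real.sin_sub, h]
  generalize Real.cos (θ - φ) = a at *
  generalize Real.sin (θ - φ) = b at *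
  simp only [circlePoint, hc, hs]
  module

variable {n : ℕ} [NeZero n] {α β m M R : ℝ} {q : Fin n → ℝ → Space3}

lemma sum_compl_odd (F : Fin n → ℝ) (hF : ∀ k, F (-k) = -F k) :
    ∑ k ∈ ({0}ᶜ : Finset (Fin n)), F k = 0 := by
  have h : ∑ k ∈ ({0}ᶜ : Finset (Fin n)), F k = ∑ k ∈ ({0}ᶜ : Finset (Fin n)), F (-k) :=
    Finset.sum_equiv (Equiv.neg _) (fun j => by simp) (fun j _ => by simp)
  simp only [hF, Finset.sum_neg_distrib] at h
  linarith

/-- The tangential forces are odd under `k ↦ -k` and cancel. The axial pulls of the centers cancel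
because `centerTwo = -centerOne` and both are equally distant. The radial parts sum to `-m • q i t`
by the balance condition. -/
lemma IsUniformCircularMotion.sum_powerForce (hbal : IsBalancedRadius n α β m M R)
    (hq : IsUniformCircularMotion R q) (i : Fin n) (t : ℝ) :
    (∑ b ∈ ({i}ᶜ : Finset (Fin n)), powerForce (m ^ 2) α (q b t) (q i t)) +
      (powerForce (m * M) β centerOne (q i t) + powerForce (m * M) β centerTwo (q i t)) =
      -m • q i t := by
  simp only [powerForce, hq.norm_sub_sq, hq.norm_sub_centerOne_sq, hq.norm_sub_centerTwo_sq]
  obtain ⟨u, v, -, -, -, -, -, rfl⟩ := isUniformCircularMotion_iff.1 hq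
  beta_reduce
  set P := circlePoint R u v (t + phase i)
  set P' := circlePoint R v (-u) (t + phase i)
  have h1 : ∀ b, P - circlePoint R u v (t + phase b) =
      (chordSq (i - b) / 2) • P + Real.sin (phase (i - b)) • P' := fun b => by
    rw [circlePoint_sub, add_sub_add_left_eq_sub, chordSq_sub, sin_phase_sub]
  simp only [h1, smul_add, smul_smul, Finset.sum_add_distrib, ← Finset.sum_smul]
  rw [sum_compl_sub (fun k => -(m ^ 2 * (α * (chordSq k * R ^ 2) ^ (-(α / 2) - 1))) *
      (chordSq k / 2)),
    sum_compl_sub (fun k => -(m ^ 2 * (α * (chordSq k * R ^ 2) ^ (-(α / 2) - 1))) *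
      Real.sin (phase k)), sum_compl_odd (fun k => -(m ^ 2 * (α * (chordSq k * R ^ 2) ^
        (-(α / 2) - 1))) * Real.sin (phase k)), zero_smul, add_zero]
  · have hC : centerTwo = -centerOne := by
      ext k; fin_cases k <;> simp [centerOne, centerTwo]
    have e : ∑ k ∈ ({0}ᶜ : Finset (Fin n)),
        -(m ^ 2 * (α * (chordSq k * R ^ 2) ^ (-(α / 2) - 1))) * (chordSq k / 2) =
        -(m - 4 * (m * M) * (β / 2 * (1 + R ^ 2) ^ (-(β / 2) - 1))) := by
      have hb := hbal
      rw [IsBalancedRadius, ← sub_eq_iff_eq_add] at hb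
      rw [hb, ← Finset.sum_neg_distrib]
      exact Finset.sum_congr rfl fun k _ => by ring
    rw [e, hC]
    module
  · intro k
    rw [chordSq_neg, ← zero_sub k, sin_phase_sub, phase_zero, zero_sub, Real.sin_neg]
    ring

lemma IsUniformCircularMotion.isPeriodicSolution (hR : 0 < R)
    (hbal : IsBalancedRadius n α β m M R) (hq : IsUniformCircularMotion R q) :
    IsPeriodicSolution α β m M q := by
  have hl := hq.mem_loopSpace hR
  refine ⟨fun i => (hl.1 i).periodic, ?_, hl.2.1, hl.2.2, fun i t => ?_⟩
  · obtain ⟨u, v, -, -, -, -, -, rfl⟩ := isUniformCircularMotion_iff.1 hq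
    exact fun i => contDiff_circlePoint _ _
  · convert hasGradientAt_potential (α := α) (β := β) (m := m) (M := M) (q := fun k => q k t)
      (fun i j hij => hl.2.1 i j hij t) (fun k => hl.2.2 k t) i using 1
    rw [hq.sum_powerForce hbal]
    obtain ⟨u, v, -, -, -, -, -, rfl⟩ := isUniformCircularMotion_iff.1 hq
    simp only [deriv_circlePoint]
    simp only [circlePoint]
    module

end equation

end

theorem mainTheorem4 {n : ℕ} [NeZero n] (hn : 2 ≤ n) (α β m M : ℝ)
    (hα : 0 < α) (hβ : 0 < β) (hm : 0 < m) (hM : 0 < M)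
    {G : Type*} [Group G] [Finite G] (g₁ g₂ : G)
    (hgen : Subgroup.closure {g₁, g₂} = (⊤ : Subgroup G))
    (ρ : G →* (Space3 ≃ₗᵢ[ℝ] Space3)) (τ : G →* (ℂ ≃ₗᵢ[ℝ] ℂ)) (σ : G →* Equiv.Perm (Fin n))
    (hρ₁ : ρ g₁ = 1) (hσ₁ : ∀ i : Fin n, σ g₁⁻¹ i = i - 1)
    (hτ₁ : τ g₁⁻¹ = rotation (Circle.exp (2 * Real.pi / n)))
    (hρ₂ : ρ g₂ = LinearIsometryEquiv.neg ℝ) (hσ₂ : ∀ i : Fin n, σ g₂⁻¹ i = i)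
    (hτ₂ : τ g₂⁻¹ = rotation (Circle.exp Real.pi)) :
    ∃ R : ℝ, 0 < R ∧
      -- the minimum of the action on the fixed point space is attained,
      (∃ q ∈ fixedLoops ρ τ σ, IsMinOn (action α β m M) (fixedLoops ρ τ σ) q) ∧
      -- exactly on the uniform circular motions of radius `R` in the `yoz`-plane,
      (∀ q : Fin n → ℝ → Space3,
        (q ∈ fixedLoops ρ τ σ ∧ IsMinOn (action α β m M) (fixedLoops ρ τ σ) q) ↔
          IsUniformCircularMotion R q) ∧
      -- which attain the minimum on the set of zero mean choreographies as well,
      -- and which solve the equations of motion.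
      ∀ q : Fin n → ℝ → Space3, IsUniformCircularMotion R q →
        (q ∈ choreographyLoops n ∧ IsMinOn (action α β m M) (choreographyLoops n) q) ∧
          IsPeriodicSolution α β m M q := by
  obtain ⟨R, hR, hbal⟩ := exists_isBalancedRadius hn hα hβ hm hM
  have hfix : ∀ {q : Fin n → ℝ → Space3}, q ∈ fixedLoops ρ τ σ ↔ _ :=
    mem_fixedLoops_iff hgen hρ₁ hσ₁ hτ₁ hρ₂ hσ₂ hτ₂
  have hsub : fixedLoops ρ τ σ ⊆ choreographyLoops n := fun q hq => by
    obtain ⟨h0, h1, h2⟩ := hfix.1 hq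
    exact mem_choreographyLoops_of_symmetric h0 h1 h2
  have hmem : ∀ q : Fin n → ℝ → Space3, IsUniformCircularMotion R q → q ∈ fixedLoops ρ τ σ :=
    fun q hq => hfix.2 ⟨hq.mem_loopSpace hR, hq.cyclic hn, hq.antiperiodic⟩
  have hmin : ∀ q : Fin n → ℝ → Space3, IsUniformCircularMotion R q →
      IsMinOn (action α β m M) (choreographyLoops n) q := fun q hq => isMinOn_iff.2 fun p hp => by
    rw [hq.action_eq hR hbal]
    exact circularAction_le hα hβ hm hM hR hbal hp
  obtain ⟨q₀, hq₀⟩ : ∃ q₀ : Fin n → ℝ → Space3, IsUniformCircularMotion R q₀ :=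
    ⟨_, isUniformCircularMotion_iff.2 ⟨EuclideanSpace.single 1 1, EuclideanSpace.single 2 1,
      by simp, by simp, by simp, by simp, by simp [EuclideanSpace.inner_single_left], rfl⟩⟩
  refine ⟨R, hR, ⟨q₀, hmem q₀ hq₀, (hmin q₀ hq₀).on_subset hsub⟩, fun q => ⟨?_, fun hq =>
    ⟨hmem q hq, (hmin q hq).on_subset hsub⟩⟩, fun q hq =>
    ⟨⟨hq.mem_choreographyLoops hR, hmin q hq⟩, hq.isPeriodicSolution hR hbal⟩⟩
  -- A minimizer does at least as well as the circular motion `q₀`, whose action is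
  -- `circularAction`; rigidity among choreographies then applies.
  rintro ⟨hq, hqmin⟩
  refine isUniformCircularMotion_of_action_le hα hβ hm hM hR hbal (hsub hq) ?_
  rw [← hq₀.action_eq hR hbal]
  exact isMinOn_iff.1 hqmin q₀ (hmem q₀ hq₀)
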